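/- **Answer format.** For an integer $m$ and an integer $k\ge 0$ let $D_k(m)$ be the set of all integers $z$ such that $z^k$ divides $m$. A *parametric family* in $\mathbb Z^n$ is given by finitely many integer parameters $u_1,u_2,\dots,u_r$, where $u_j$ ranges over $\mathbb Z$ or over a finite intersection of sets $D_k(m)$ with $m$ a rational expression (with integer constants) in the earlier parameters $u_1,\dots,u_{j-1}$, in each case possibly with the value $0$ left out, together with rational expressions $x_i=X_i(u_1,\dots,u_r)$, $i=1,\dots,n$. It is *well defined* if, for all values that the parameters may take, no division by zero occurs and all the expressions $m$ and $X_i$ take integer values. **Three-monomial equations.** Consider equations $$a_0\prod_{i=1}^n x_i^{\alpha_{0i}}+a_1\prod_{i=1}^n x_i^{\alpha_{1i}}+a_2\prod_{i=1}^n x_i^{\alpha_{2i}}=0\qquad(1)$$ with non-zero integers $a_0,a_1,a_2$ and non-negative integers $\alpha_{ji}$. Say that (1) *satisfies the condition* if it can be written (by a choice of which monomial stands on the right) in the form $a\prod_i x_i^{\alpha_i}+b\prod_i x_i^{\beta_i}=c\prod_i x_i^{\gamma_i}$ so that the system $$\sum_{i=1}^n\alpha_i z_i=\sum_{i=1}^n\beta_i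 z_i=\sum_{i=1}^n\gamma_i z_i-1$$ has a solution in non-negative integers $z_1,\dots,z_n$. **Reduction.** Read the indices $j\in\{0,1,2\}$ modulo $3$, write $\alpha_j\cdot z=\sum_i\alpha_{ji}z_i$, let $v_p$ be the exponent of the prime $p$ in an integer, and let "minimal" refer to the componentwise order. Let $e_{j,1},\dots,e_{j,N_j}$ be the minimal non-zero solutions $z\in\mathbb Z_{\ge0}^n$ of $\alpha_{j+1}\cdot z=\alpha_{j+2}\cdot z$, and put $\epsilon_{j,k}=\alpha_j\cdot e_{j,k}-\alpha_{j+1}\cdot e_{j,k}$. Distribute the primes dividing $a_0a_1a_2$ in any way into three classes $\mathcal P_0,\mathcal P_1,\mathcal P_2$; for each such $p\in\mathcal P_j$ choose a minimal solution $z^0_p\in\mathbb Z_{\ge0}^n$ of $v_p(a_{j+1})+\alpha_{j+1}\cdot z=v_p(a_{j+2})+\alpha_{j+2}\cdot z$ (so $z_p^0=0$ if this equation is homogeneous), and choose signs. Put $$A_j=\pm\prod_{p\in\mathcal P_j}p^{\,v_p(a_j)-v_p(a_{j+1})+\alpha_j\cdot z_p^0-\alpha_{j+1}\cdot z_p^0},$$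 and in the equation $\sum_{j}A_j\prod_{k=1}^{N_j}U_{j,k}^{\epsilon_{j,k}}=0$ replace each term, which we write as $\frac sq\prod_k U_k^{\epsilon_k}$ with $\frac sq$ in lowest terms and $q>0$, as follows: * if all $\epsilon_k\le0$: by an integer constant dividing $\frac sq$, provided that $\frac sq$ is an integer; * if the $\epsilon_k$ take both signs: by $\frac{s}{v^d}\frac{(q^*)^d}{q}U^d$, where $d=\gcd_k(\epsilon_k)$, $v$ is a positive integer with $v^d\mid s$, $q^*$ is the least positive integer with $q\mid (q^*)^d$, and $U$ is a new variable; * if all $\epsilon_k\ge0$: by $s\,\frac{\prod_k d_k^{\epsilon_k}}{q}\prod_k (U'_k)^{\epsilon_k}$, where $(d_k)$ is a tuple of positive integers with $q\mid\prod_k d_k^{\epsilon_k}$, minimal with respect to divisibility of the entries, and $U'_k$ are new variables. The equations with integer coefficients, and with monomials in disjoint sets of variables, that arise in this way are the equations to which the reduction leads. **Proposition.** 1. There is an algorithm that, given any equation (1) satisfying the condition (that is, given the $a_j$ and the $\alpha_{ji}$; the number $n$ of variables is part of the input), outputs a finite list of well-defined parametric families in $\mathbb Z^n$ whose union is the set of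 all integer solutions of (1). 2. If (1) satisfies the condition, then every equation to which the reduction leads is, up to the names of the variables, of one of the following two forms: it is linear in one variable, that is, $a y_1+Q(y_2,\dots,y_m)=0$ with an integer $a\ne0$ and an integer polynomial $Q$; or it is of the form $P(y_1^k y_2,y_3,\dots,y_m)=0$ with $k\ge1$ and an integer polynomial $P$ such that the equation $P(y_2,y_3,\dots,y_m)=0$ is again of one of these two forms. -/

import Mathlib

/-! Three-monomial Diophantine equations, a format in which solution sets are described, and the
reduction of a three-monomial equation to equations with independent monomials. -/

namespace ThreeMon

/-! ### The answer format -/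

/-- Rational expressions with integer constants in the parameters `u₀, u₁, u₂, …`. -/
inductive Expr : Type
  | const : ℤ → Expr
  | var : ℕ → Expr
  | add : Expr → Expr → Expr
  | mul : Expr → Expr → Expr
  | div : Expr → Expr → Expr
  | pow : Expr → ℕ → Expr

namespace Expr

/-- The Gödel number of an expression. -/
def code : Expr → ℕ
  | const z => 6 * Encodable.encode z
  | var i => 6 * i + 1
  | add a b => 6 * Nat.pair a.code b.code + 2
  | mul a b => 6 * Nat.pair a.code b.code + 3
  | div a b => 6 * Nat.pair a.code b.code + 4
  | pow a k => 6 * Nat.pair a.code k + 5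

/-- The expression with a given Gödel number. -/
def ofCode (n : ℕ) : Expr :=
  if h0 : n % 6 = 0 then const (Denumerable.ofNat ℤ (n / 6))
  else if h1 : n % 6 = 1 then var (n / 6)
  else
    have hn : n / 6 < n := by omega
    have hl : (n / 6).unpair.1 < n := lt_of_le_of_lt (Nat.unpair_left_le _) hn
    have hr : (n / 6).unpair.2 < n := lt_of_le_of_lt (Nat.unpair_right_le _) hn
    if n % 6 = 2 then add (ofCode (n / 6).unpair.1) (ofCode (n / 6).unpair.2)
    else if n % 6 = 3 then mul (ofCode (n / 6).unpair.1) (ofCode (n / 6).unpair.2)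
    else if n % 6 = 4 then div (ofCode (n / 6).unpair.1) (ofCode (n / 6).unpair.2)
    else pow (ofCode (n / 6).unpair.1) (n / 6).unpair.2
termination_by n

theorem ofCode_code (e : Expr) : ofCode e.code = e := by
  induction e with
  | const z =>
    have h : 6 * Encodable.encode z / 6 = Encodable.encode z := by omega
    rw [code, ofCode, dif_pos (by omega), h, Denumerable.ofNat_encode]
  | var i =>
    rw [code, ofCode, dif_neg (by omega), dif_pos (by omega)]
    congr 1; omega
  | add a b iha ihb =>
    have h : (6 * Nat.pair a.code b.code + 2) / 6 = Nat.pair a.code b.code := by omega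
    rw [code, ofCode, dif_neg (by omega), dif_neg (by omega), if_pos (by omega), h]
    simp [iha, ihb]
  | mul a b iha ihb =>
    have h : (6 * Nat.pair a.code b.code + 3) / 6 = Nat.pair a.code b.code := by omega
    rw [code, ofCode, dif_neg (by omega), dif_neg (by omega), if_neg (by omega),
      if_pos (by omega), h]
    simp [iha, ihb]
  | div a b iha ihb =>
    have h : (6 * Nat.pair a.code b.code + 4) / 6 = Nat.pair a.code b.code := by omega
    rw [code, ofCode, dif_neg (by omega), dif_neg (by omega), if_neg (by omega),
      if_neg (by omega), if_pos (by omega), h]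
    simp [iha, ihb]
  | pow a k iha =>
    have h : (6 * Nat.pair a.code k + 5) / 6 = Nat.pair a.code k := by omega
    rw [code, ofCode, dif_neg (by omega), dif_neg (by omega), if_neg (by omega),
      if_neg (by omega), if_neg (by omega), h]
    simp [iha]

theorem code_ofCode (n : ℕ) : (ofCode n).code = n := by
  induction n using Nat.strong_induction_on with
  | _ n ih =>
    rw [ofCode]
    by_cases h0 : n % 6 = 0
    · rw [dif_pos h0, code, Denumerable.encode_ofNat]; omega
    by_cases h1 : n % 6 = 1
    · rw [dif_neg h0, dif_pos h1, code]; omega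
    have hn : n / 6 < n := by omega
    have hl := ih _ (lt_of_le_of_lt (Nat.unpair_left_le (n / 6)) hn)
    have hr := ih _ (lt_of_le_of_lt (Nat.unpair_right_le (n / 6)) hn)
    rw [dif_neg h0, dif_neg h1]
    split_ifs <;> simp only [code, hl, hr, Nat.pair_unpair] <;> omega

instance : Denumerable Expr :=
  Denumerable.mk' ⟨code, ofCode, ofCode_code, code_ofCode⟩

/-- The value of an expression at the parameter values `u`, or `none` if it is undefined there
(a division by zero, or a parameter that is not among those listed in `u`). -/
def eval (u : List ℤ) : Expr → Option ℚ
  | const z => some z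
  | var i => (u[i]?).map fun z : ℤ => (z : ℚ)
  | add a b => do return (← a.eval u) + (← b.eval u)
  | mul a b => do return (← a.eval u) * (← b.eval u)
  | div a b => do
      let x ← a.eval u
      let y ← b.eval u
      if y = 0 then none else some (x / y)
  | pow a k => do return (← a.eval u) ^ k

/-- At the parameter values `u`, the expression is defined and its value is an integer. -/
def IsIntegerAt (e : Expr) (u : List ℤ) : Prop :=
  ∃ m : ℤ, e.eval u = some (m : ℚ)

end Expr

/-- `D k m` is the set of all integers `z` such that `z ^ k` is a divisor of `m`. -/
def D (k : ℕ) (m : ℤ) : Set ℤ := {z | z ^ k ∣ m}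

/-- The range of a parameter: the intersection of the sets `D k e` for the listed pairs `(k, e)`
(all of `ℤ` if none is listed), with `0` left out if the flag is `true`. -/
abbrev ParamRange : Type := Bool × List (ℕ × Expr)

/-- `z` is in the range `r` when the earlier parameters have the values `u`. -/
def ParamRange.Contains (r : ParamRange) (u : List ℤ) (z : ℤ) : Prop :=
  (r.1 = true → z ≠ 0) ∧
    ∀ q ∈ r.2, ∃ m : ℤ, q.2.eval u = some (m : ℚ) ∧ z ∈ D q.1 m

/-- The values `u` can be given to parameters with the successive ranges `rs`. -/
def Admissible (rs : List ParamRange) (u : List ℤ) : Prop :=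
  u.length = rs.length ∧
    ∀ (i : ℕ) (r : ParamRange) (z : ℤ), rs[i]? = some r → u[i]? = some z →
      r.Contains (u.take i) z

/-- A parametric family of integer points: the ranges of its parameters, each depending on the
earlier parameters, and an expression in the parameters for each coordinate. -/
abbrev Family : Type := List ParamRange × List Expr

/-- The family is a meaningful description of points of `ℤⁿ`: the expressions `m` in the ranges
`D k m` and the `n` coordinates are defined and integral for all admissible parameters. -/
def Family.WellDefined (F : Family) (n : ℕ) : Prop :=
  (∀ (i : ℕ) (r : ParamRange), F.1[i]? = some r →
    ∀ u : List ℤ, Admissible (F.1.take i) u → ∀ q ∈ r.2, q.2.IsIntegerAt u) ∧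
  F.2.length = n ∧
  ∀ u : List ℤ, Admissible F.1 u → ∀ e ∈ F.2, e.IsIntegerAt u

/-- The set of the points of `ℤⁿ` that the family describes. -/
def Family.points (F : Family) (n : ℕ) : Set (Fin n → ℤ) :=
  {x | ∃ u : List ℤ, Admissible F.1 u ∧
    F.2.map (fun e => e.eval u) = List.ofFn fun i => some (x i : ℚ)}

/-! ### Three-monomial equations -/

/-- A three-monomial equation
`a₀ ∏ xᵢ ^ (α₀ᵢ) + a₁ ∏ xᵢ ^ (α₁ᵢ) + a₂ ∏ xᵢ ^ (α₂ᵢ) = 0`, given by its coefficients and, for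
every variable, its exponents in the three monomials. -/
abbrev Equation : Type := (Fin 3 → ℤ) × List (Fin 3 → ℕ)

namespace Equation

/-- The number of variables. -/
abbrev nvars (E : Equation) : ℕ := E.2.length

/-- The coefficient of the monomial `j`. -/
def coeff (E : Equation) (j : Fin 3) : ℤ := E.1 j

/-- The exponent of the variable `i` in the monomial `j`. -/
def exponent (E : Equation) (j : Fin 3) (i : Fin E.nvars) : ℕ := E.2[i] j

def IsSolution (E : Equation) (x : Fin E.nvars → ℤ) : Prop :=
  ∑ j, E.coeff j * ∏ i, x i ^ E.exponent j i = 0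

/-- `∑ᵢ αⱼᵢ zᵢ`, where `αⱼᵢ` are the exponents in the monomial `j`. -/
def weight (E : Equation) (j : Fin 3) (z : Fin E.nvars → ℕ) : ℕ :=
  ∑ i, E.exponent j i * z i

/-- For some way to write the equation as `a ∏ xᵢ ^ αᵢ + b ∏ xᵢ ^ βᵢ = c ∏ xᵢ ^ γᵢ`, the system
`∑ αᵢ zᵢ = ∑ βᵢ zᵢ = ∑ γᵢ zᵢ - 1` is solvable in non-negative integers (here `i`, `j`, `k`
are the monomials with the exponents `α`, `β`, `γ`). -/
def Condition (E : Equation) : Prop :=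
  ∃ i j k : Fin 3, i ≠ j ∧ i ≠ k ∧ j ≠ k ∧ ∃ z : Fin E.nvars → ℕ,
    (E.weight i z : ℤ) = E.weight j z ∧ (E.weight j z : ℤ) = E.weight k z - 1

end Equation

/-! ### The reduction to equations with independent monomials -/

/-- An equation with independent monomials: three terms `c ∏ₖ yₖ ^ eₖ`, each with variables of
its own, given by `c` and the list of the `eₖ`. -/
abbrev IndepEquation : Type := Fin 3 → ℤ × List ℕ

/-- The left-hand side of the equation; `X (j, k)` is the variable `k` of the term `j`. -/
noncomputable def IndepEquation.poly (R : IndepEquation) : MvPolynomial (Fin 3 × ℕ) ℤ :=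
  ∑ j : Fin 3, MvPolynomial.C (R j).1 *
    ∏ k : Fin (R j).2.length, MvPolynomial.X (j, (k : ℕ)) ^ (R j).2[k]

/-- `P = 0` is linear in a variable, that is, of the form `a xᵢ + Q = 0` with `a ≠ 0` and without
`xᵢ` in `Q`; or it is of the form `Q(x₁ ^ k x₂, x₃, …) = 0`, up to the names of the
variables, where `k ≥ 1` and `Q(x₂, x₃, …) = 0` is again of one of these two forms. -/
inductive ElementaryForm {σ : Type} [DecidableEq σ] : MvPolynomial σ ℤ → Prop
  | linear (a : ℤ) (i : σ) (Q : MvPolynomial σ ℤ) (ha : a ≠ 0) (hi : i ∉ Q.vars) :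
      ElementaryForm (MvPolynomial.C a * MvPolynomial.X i + Q)
  | powMul (i₁ i₂ : σ) (k : ℕ) (Q : MvPolynomial σ ℤ) (hne : i₁ ≠ i₂) (hk : 1 ≤ k)
      (hi : i₁ ∉ Q.vars) (hQ : ElementaryForm Q) :
      ElementaryForm (MvPolynomial.bind₁
        (Function.update MvPolynomial.X i₂ (MvPolynomial.X i₁ ^ k * MvPolynomial.X i₂)) Q)

/-- `d` is a minimal tuple of positive integers, with respect to divisibility of the entries, such
that `∏ₖ dₖ ^ eₖ` is divisible by `q`. -/
def IsMinimalTuple (q : ℕ) (es : List ℕ) (d : Fin es.length → ℕ) : Prop :=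
  (∀ k, 0 < d k) ∧ q ∣ ∏ k, d k ^ es[k] ∧
    ∀ d' : Fin es.length → ℕ, (∀ k, 0 < d' k ∧ d' k ∣ d k) → q ∣ ∏ k, d' k ^ es[k] → d' = d

/-- The terms `(t, [e'₁, e'₂, …])`, meaning `t ∏ₖ y'ₖ ^ e'ₖ` with an integer `t` and
non-negative exponents, by which a term `r ∏ₖ yₖ ^ eₖ` with rational `r` and integer exponents
`eₖ` is replaced. -/
inductive Replacement (r : ℚ) (es : List ℤ) : ℤ × List ℕ → Prop
  /-- All exponents are non-positive: a divisor of `r`, provided that `r` is an integer. -/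
  | nonpos (c m : ℤ) (hes : ∀ e ∈ es, e ≤ 0) (hr : r = c) (hm : m ∣ c) : Replacement r es (m, [])
  /-- Both signs occur: an integer multiple of the power `y' ^ d`, where `d` is the greatest common
  divisor of the exponents. -/
  | mixed (d v q : ℕ) (t : ℤ) (hpos : ∃ e ∈ es, 0 < e) (hneg : ∃ e ∈ es, e < 0)
      (hd : d = (es.map Int.natAbs).foldr Nat.gcd 0)
      (hv : 0 < v) (hvr : (v : ℤ) ^ d ∣ r.num) (hq : IsLeast {q : ℕ | 0 < q ∧ r.den ∣ q ^ d} q)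
      (ht : (t : ℚ) = r * (q : ℚ) ^ d / (v : ℚ) ^ d) : Replacement r es (t, [d])
  /-- All exponents are non-negative: the substitution `yₖ = dₖ y'ₖ`. -/
  | nonneg (ks : List ℕ) (d : Fin ks.length → ℕ) (t : ℤ)
      (hes : es = ks.map fun k => (k : ℤ)) (hd : IsMinimalTuple r.den ks d)
      (ht : (t : ℚ) = r * ∏ k, (d k : ℚ) ^ ks[k]) : Replacement r es (t, ks)

namespace Equation

/-! In what follows `j : Fin 3` stands for a monomial, and `j + 1`, `j + 2` (computed modulo 3) are
the two other ones. A prime is in the class `j` if it enters the monomials `j + 1` and `j + 2`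
with the same exponent. -/

/-- `l` is a complete list of the minimal non-zero solutions in non-negative integers to
`∑ᵢ αⱼ₊₁,ᵢ zᵢ = ∑ᵢ αⱼ₊₂,ᵢ zᵢ`. -/
def IsListOfMinimalSolutions (E : Equation) (j : Fin 3) (l : List (Fin E.nvars → ℕ)) : Prop :=
  l.Nodup ∧ ∀ z, z ∈ l ↔
    Minimal (fun z => z ≠ 0 ∧ E.weight (j + 1) z = E.weight (j + 2) z) z

/-- The exponent of `p` in the coefficient of the monomial `j`. -/
def coeffVal (E : Equation) (p : ℕ) (j : Fin 3) : ℕ := padicValInt p (E.coeff j)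

/-- `z` is a minimal solution in non-negative integers to the equation
`v_p(aⱼ₊₁) + ∑ᵢ αⱼ₊₁,ᵢ zᵢ = v_p(aⱼ₊₂) + ∑ᵢ αⱼ₊₂,ᵢ zᵢ`, which for a homogeneous equation means
`z = 0`. -/
def IsBaseSolution (E : Equation) (p : ℕ) (j : Fin 3) (z : Fin E.nvars → ℕ) : Prop :=
  Minimal (fun z => E.coeffVal p (j + 1) + E.weight (j + 1) z =
    E.coeffVal p (j + 2) + E.weight (j + 2) z) z

/-- `∑ᵢ (αⱼᵢ - αⱼ₊₁,ᵢ) zᵢ`. -/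
def netExponent (E : Equation) (j : Fin 3) (z : Fin E.nvars → ℕ) : ℤ :=
  (E.weight j z : ℤ) - E.weight (j + 1) z

/-- The product over the primes `p` in the class `j` that divide a coefficient of the equation, of
the powers of `p` that are left in the monomial `j` when the common factors are cancelled;
`cls p` is the class of `p` and `z₀ p` is the chosen minimal solution. -/
noncomputable def reducedCoeff (E : Equation) (cls : ℕ → Fin 3) (z₀ : ℕ → Fin E.nvars → ℕ)
    (j : Fin 3) : ℚ :=
  ∏ p ∈ (∏ i, E.coeff i).natAbs.primeFactors with cls p = j,
    (p : ℚ) ^ ((E.coeffVal p j : ℤ) - E.coeffVal p (j + 1) + E.netExponent j (z₀ p))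

/-- `R` is one of the equations with independent monomials to which `E` is reduced. They arise from
all distributions of the primes that divide a coefficient into the three classes, all choices of
a minimal solution for each of these primes, all choices of signs, and all replacements of the
three terms. -/
def ReducesTo (E : Equation) (R : IndepEquation) : Prop :=
  ∃ (l : Fin 3 → List (Fin E.nvars → ℕ)) (cls : ℕ → Fin 3) (z₀ : ℕ → Fin E.nvars → ℕ)
    (s : Fin 3 → ℤˣ),
    (∀ j, E.IsListOfMinimalSolutions j (l j)) ∧
    (∀ p ∈ (∏ i, E.coeff i).natAbs.primeFactors, E.IsBaseSolution p (cls p) (z₀ p)) ∧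
    ∀ j, Replacement (((s j : ℤ) : ℚ) * E.reducedCoeff cls z₀ j)
      ((l j).map (E.netExponent j)) (R j)

end Equation

end ThreeMon

/-! ### Linear equations and inequalities in non-negative integers, with explicit bounds. -/

namespace ThreeMon

/-! Solving the equation. Fix a solution at which no term vanishes, and a prime `p`. The three terms
have sum zero, so the least of their `p`-exponents occurs at least twice
(`padicValInt_eq_of_add_eq_zero`). Hence the vector of the `p`-exponents of the coordinates
satisfies one of three systems, each made of a linear equation and a linear inequality. A solution
of such a system in non-negative integers is a bounded vector plus a sum of bounded solutions `e_k`
of the homogeneous system (`exists_bounded_add_closure_system`), and the bounded vector is zero if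
`p` divides no coefficient. Multiplying over all primes gives `x = x₀ ∏ U_k ^ e_k` with `x₀` from a
finite set (`exists_eq_mul_prod_pow`, `Equation.exists_basePoint`).

After this substitution and the cancellation of common factors, an equation `A ∏ S ^ d = B ∏ U ^ b +
C ∏ U ^ c` is left, in which the two sides have separate variables. The condition supplies an
exponent vector `z` whose weight is equal in two monomials and larger by one in the third, which is
taken as the term on the left. Scaling by one more variable `W` along `z` replaces the equation by
`A W ∏ S ^ d = B ∏ U ^ b + C ∏ U ^ c`. This loses nothing, because the given solution has `W = 1`,
and it can be solved for `W`: take the `U` in residue classes modulo `A` that make the right side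
divisible by `A`, then choose the `S` one after another so that their powers divide what is left of
the quotient. Every choice of these parameters gives a solution.

If a term vanishes, then either all terms vanish or the other two are opposite. The exponent vectors
of the primes then satisfy at most one equation, and scaling a solution `x₀` along vectors that have
equal weight in the surviving terms gives all such points. All searches run over explicit boxes, so
the algorithm is primitive recursive.

The reduction. By the condition some `j` and some `z`, a sum of the minimal solutions `e_{j,k}`,
give `∑ ε = 1` over the summands. So the `ε_{j,k}` are not all non-positive; if both signs occur,
their gcd is 1; if all are non-negative, one of them is 1. In each possible case the term `j`
receives a variable with exponent 1 and a non-zero coefficient, and the remaining variables of this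
term are absorbed into it one at a time (`elementaryForm_of_linear_term`). -/

/-- Bound for the entries of the indecomposable solutions of a linear equation in `n` unknowns whose
coefficients are at most `C` in absolute value. -/
def eqBound (n C : ℕ) : ℕ := n * C ^ 2 + C + 1

/-- A solution of a linear equation in non-negative integers is the sum of a bounded solution and
of bounded solutions of the homogeneous equation. -/
theorem exists_bounded_add_closure {ι : Type*} [Fintype ι] [DecidableEq ι] (w : ι → ℤ) (c : ℤ) (C : ℕ)
    (hw : ∀ i, |w i| ≤ C) (hc : |c| ≤ C) (z : ι → ℕ) (hz : c + ∑ i, w i * z i = 0) :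
    ∃ z₀ y : ι → ℕ, z = z₀ + y ∧ (∀ i, z₀ i ≤ eqBound (Fintype.card ι) C) ∧
      c + ∑ i, w i * z₀ i = 0 ∧
      y ∈ AddSubmonoid.closure {e : ι → ℕ | (∀ i, e i ≤ eqBound (Fintype.card ι) C) ∧
        ∑ i, w i * e i = 0} := by
  induction hN : ∑ i, z i using Nat.strong_induction_on generalizing z with
  | _ N ih =>
  -- The induction is on the sum of the entries: it suffices to find below `z` a non-zero bounded
  -- solution of the homogeneous equation, which is then split off.
  have step : ∀ e : ι → ℕ, e ≠ 0 → e ≤ z → (∀ i, e i ≤ eqBound (Fintype.card ι) C) →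
      ∑ i, w i * e i = 0 → ∃ z₀ y : ι → ℕ, z = z₀ + y ∧
      (∀ i, z₀ i ≤ eqBound (Fintype.card ι) C) ∧ c + ∑ i, w i * z₀ i = 0 ∧
      y ∈ AddSubmonoid.closure {e : ι → ℕ | (∀ i, e i ≤ eqBound (Fintype.card ι) C) ∧
        ∑ i, w i * e i = 0} := by
    intro e he hez heB hew
    obtain ⟨z', rfl⟩ : ∃ z', z = z' + e := ⟨z - e, (tsub_add_cancel_of_le hez).symm⟩
    have hpos : 0 < ∑ i, e i := by
      rw [Nat.pos_iff_ne_zero]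
      intro h0
      exact he (funext fun i => by simpa using (Finset.sum_eq_zero_iff.mp h0) i (Finset.mem_univ i))
    have hlt : ∑ i, z' i < N := by
      rw [← hN]; simp only [Pi.add_apply, Finset.sum_add_distrib]; omega
    have hz' : c + ∑ i, w i * z' i = 0 := by
      simp only [Pi.add_apply, Nat.cast_add, mul_add, Finset.sum_add_distrib, hew] at hz
      simpa using hz
    obtain ⟨z₀, y, h1, h2, h3, h4⟩ := ih _ hlt z' hz' rfl
    refine ⟨z₀, y + e, by rw [h1, add_assoc], h2, h3, add_mem h4 (AddSubmonoid.subset_closure ⟨heB, hew⟩)⟩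
  by_cases h0 : ∃ i, w i = 0 ∧ 0 < z i
  · obtain ⟨i, hi, hzi⟩ := h0
    refine step (Pi.single i 1) (by simp) ?_ ?_ ?_
    · intro k
      by_cases hk : k = i
      · subst hk; simpa using Nat.one_le_iff_ne_zero.mpr hzi.ne'
      · simp [hk]
    · intro k
      by_cases hk : k = i
      · subst hk; simp [eqBound]
      · simp [hk]
    · rw [Finset.sum_eq_single i] <;> simp +contextual [hi]
  push Not at h0
  -- Large entries at coefficients of opposite signs: the vector with `|w k|` at `i` and `|w i|` at
  -- `k` solves the homogeneous equation and lies below `z`.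
  by_cases h1 : ∃ i k, 0 < w i ∧ w k < 0 ∧ C ≤ z i ∧ C ≤ z k
  · obtain ⟨i, k, hi, hk, hzi, hzk⟩ := h1
    have hik : i ≠ k := by rintro rfl; omega
    have hCi := abs_le.mp (hw i)
    have hCk := abs_le.mp (hw k)
    have hki : ((w i).natAbs : ℤ) = w i := by rw [Int.natCast_natAbs, abs_of_pos hi]
    have hkk : ((w k).natAbs : ℤ) = -w k := by rw [Int.natCast_natAbs, abs_of_neg hk]
    have hval : ∀ l, (Pi.single i (w k).natAbs + Pi.single k (w i).natAbs : ι → ℕ) l =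
        if l = i then (w k).natAbs else if l = k then (w i).natAbs else 0 := by
      intro l
      by_cases h : l = i
      · subst h; simp [hik]
      · by_cases h' : l = k
        · subst h'; simp [h]
        · simp [h, h']
    refine step (Pi.single i (w k).natAbs + Pi.single k (w i).natAbs) ?_ ?_ ?_ ?_
    · intro h
      have := congrFun h i
      rw [hval] at this
      simp at this; omega
    · refine fun l => (hval l).trans_le ?_
      split_ifs with h h'
      · subst h; omega
      · subst h'; omega
      · omega
    · refine fun l => (hval l).trans_le ?_
      have : C ≤ eqBound (Fintype.card ι) C := by unfold eqBound; omega
      split_ifs <;> omega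
    · simp only [hval]
      rw [← Finset.sum_subset (Finset.subset_univ {i, k})]
      · rw [Finset.sum_pair hik]
        simp only [if_true, if_neg hik.symm]
        rw [hki, hkk]; ring
      · intro l _ hl
        simp only [Finset.mem_insert, Finset.mem_singleton, not_or] at hl
        simp [hl.1, hl.2]
  push Not at h1
  -- If nothing can be split off, the entries at the coefficients of one sign are all below `C`. The
  -- equation then bounds each entry at a coefficient of the other sign by `C + n * C ^ 2`, which is
  -- where `eqBound` comes from. The sign of the equation is reversed if necessary.
  have key : ∀ (w' : ι → ℤ) (c' : ℤ), (∀ i, |w' i| ≤ C) → |c'| ≤ C → c' + ∑ i, w' i * z i = 0 →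
      (∀ i, 0 < w' i → z i < C) → (∀ i, w' i = 0 → z i = 0) →
      ∀ i, z i ≤ eqBound (Fintype.card ι) C := by
    intro w' c' hw' hc' hz' hp hzero i
    rcases lt_trichotomy (w' i) 0 with h | h | h
    · have h2 : ∑ k ∈ Finset.univ.erase i, w' k * z k ≤ ∑ k ∈ Finset.univ.erase i, (C : ℤ) ^ 2 := by
        refine Finset.sum_le_sum fun k _ => ?_
        rcases le_or_gt (w' k) 0 with h3 | h3
        · exact (mul_nonpos_of_nonpos_of_nonneg h3 (by positivity)).trans (by positivity)
        · have := hp k h3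
          have := (abs_le.mp (hw' k)).2
          rw [sq]
          exact mul_le_mul this (by exact_mod_cast (hp k h3).le) (by positivity) (by positivity)
      rw [Finset.sum_const, nsmul_eq_mul] at h2
      have h3 : ((Finset.univ.erase i).card : ℤ) ≤ Fintype.card ι := by
        exact_mod_cast Finset.card_le_univ _
      have h4 := mul_le_mul_of_nonneg_right h3 (by positivity : (0 : ℤ) ≤ (C : ℤ) ^ 2)
      rw [← Finset.add_sum_erase _ _ (Finset.mem_univ i)] at hz'
      have h5 : (z i : ℤ) ≤ - (w' i * z i) := by nlinarith [(by positivity : (0 : ℤ) ≤ z i)]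
      have h6 := (abs_le.mp hc').2
      have : (z i : ℤ) ≤ (eqBound (Fintype.card ι) C : ℕ) := by
        unfold eqBound; push_cast; linarith
      exact_mod_cast this
    · rw [hzero i h]; exact Nat.zero_le _
    · have := hp i h
      unfold eqBound
      omega
  refine ⟨z, 0, by simp, ?_, hz, zero_mem _⟩
  by_cases h2 : ∀ i, 0 < w i → z i < C
  · exact key w c hw hc hz h2 fun i hi => by simpa using h0 i hi
  · push Not at h2
    obtain ⟨i, hi, hzi⟩ := h2
    refine key (fun i => - w i) (-c) (by simpa using hw) (by simpa using hc) ?_ ?_ ?_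
    · simp only [neg_mul, Finset.sum_neg_distrib]; linarith
    · intro k hk
      exact h1 i k hi (by simpa using hk) hzi
    · intro i hi; simpa using h0 i (by simpa using hi)

/-- Bound for the entries of the indecomposable solutions of an equation and an inequality. -/
def sysBound (n C : ℕ) : ℕ :=
  -- The first summand bounds a particular solution of the equation. The second is the number of
  -- generators, times the bound for their multiplicities, times the bound for their entries.
  eqBound n C + (eqBound n C + 1) ^ n *
    (eqBound ((eqBound n C + 1) ^ n + 1) (C + n * C * eqBound n C + 1) * eqBound n C)

theorem abs_sum_mul_le {ι : Type*} [Fintype ι] (w : ι → ℤ) (C B : ℕ) (hw : ∀ i, |w i| ≤ C)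
    (z : ι → ℕ) (hz : ∀ i, z i ≤ B) : |∑ i, w i * z i| ≤ (Fintype.card ι * C * B : ℕ) := by
  calc |∑ i, w i * z i| ≤ ∑ i, |w i * z i| := Finset.abs_sum_le_sum_abs _ _
    _ ≤ ∑ _i : ι, (C * B : ℤ) := by
        refine Finset.sum_le_sum fun i _ => ?_
        rw [abs_mul, Nat.abs_cast]
        exact mul_le_mul (hw i) (by exact_mod_cast hz i) (by positivity) (by positivity)
    _ = _ := by simp [mul_assoc]

/-- A solution of an equation and an inequality in non-negative integers is the sum of a bounded
solution and of bounded solutions of the homogeneous system. -/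
theorem exists_bounded_add_closure_system {n : ℕ} (f g : Fin n → ℤ) (c c' : ℤ) (C : ℕ)
    (hf : ∀ i, |f i| ≤ C) (hg : ∀ i, |g i| ≤ C) (hc : |c| ≤ C) (hc' : |c'| ≤ C)
    (z : Fin n → ℕ) (hz : c + ∑ i, f i * z i = 0) (hz' : 0 ≤ c' + ∑ i, g i * z i) :
    ∃ z₀ y : Fin n → ℕ, z = z₀ + y ∧ (∀ i, z₀ i ≤ sysBound n C) ∧ (c = 0 → c' = 0 → z₀ = 0) ∧
      y ∈ AddSubmonoid.closure {e : Fin n → ℕ | (∀ i, e i ≤ sysBound n C) ∧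
        ∑ i, f i * e i = 0 ∧ 0 ≤ ∑ i, g i * e i} := by
  set M := {e : Fin n → ℕ | (∀ i, e i ≤ sysBound n C) ∧ ∑ i, f i * e i = 0 ∧ 0 ≤ ∑ i, g i * e i}
    with hM
  set B := eqBound n C with hB
  -- In the homogeneous case the bounded part is itself one of the generators and can be moved into
  -- `y`.
  suffices H : ∃ z₀ y : Fin n → ℕ, z = z₀ + y ∧ (∀ i, z₀ i ≤ sysBound n C) ∧
      c + ∑ i, f i * z₀ i = 0 ∧ 0 ≤ c' + ∑ i, g i * z₀ i ∧ y ∈ AddSubmonoid.closure M by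
    obtain ⟨z₀, y, h1, h2, h3, h4, h5⟩ := H
    by_cases h : c = 0 ∧ c' = 0
    · refine ⟨0, z₀ + y, by simp [h1], by simp, by simp, add_mem (AddSubmonoid.subset_closure ⟨h2, ?_⟩) h5⟩
      obtain ⟨rfl, rfl⟩ := h
      simpa using And.intro h3 h4
    · exact ⟨z₀, y, h1, h2, fun h6 h7 => absurd ⟨h6, h7⟩ h, h5⟩
  obtain ⟨z₁, y₁, rfl, hz₁, hcz₁, hy₁⟩ := exists_bounded_add_closure f c C hf hc z hz
  rw [Fintype.card_fin] at hz₁ hy₁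
  let G : Finset (Fin n → ℕ) :=
    (Fintype.piFinset fun _ => Finset.range (B + 1)).filter fun e => ∑ i, f i * (e i : ℤ) = 0
  have hG : ∀ e, e ∈ G ↔ (∀ i, e i ≤ B) ∧ ∑ i, f i * (e i : ℤ) = 0 := by
    intro e; simp [G]
  have hGcard : G.card ≤ (B + 1) ^ n := by
    refine (Finset.card_filter_le _ _).trans ?_
    simp
  have hset : {e : Fin n → ℕ | (∀ i, e i ≤ eqBound n C) ∧ ∑ i, f i * (e i : ℤ) = 0} =
      Set.range (fun e : G => (e : Fin n → ℕ)) := by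
    ext e; simp [hG, hB]
  rw [hset, AddSubmonoid.mem_closure_range_iff_of_fintype] at hy₁
  obtain ⟨m, rfl⟩ := hy₁
  let φ : (Option G → ℕ) →+ (Fin n → ℕ) :=
    { toFun := fun u => ∑ e : G, u (some e) • (e : Fin n → ℕ)
      map_zero' := by simp
      map_add' := fun a b => by simp [add_smul, Finset.sum_add_distrib] }
  have hφ : ∀ u, φ u = ∑ e : G, u (some e) • (e : Fin n → ℕ) := fun _ => rfl
  have hφi : ∀ u i, φ u i = ∑ e : G, u (some e) * (e : Fin n → ℕ) i := by
    intro u i; simp [hφ]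
  have hlin : ∀ (h : Fin n → ℤ) u, ∑ i, h i * (φ u i : ℤ) =
      ∑ e : G, (∑ i, h i * ((e : Fin n → ℕ) i : ℤ)) * u (some e) := by
    intro h u
    simp only [hφi, Nat.cast_sum, Finset.mul_sum, Finset.sum_mul]
    rw [Finset.sum_comm]
    refine Finset.sum_congr rfl fun e _ => Finset.sum_congr rfl fun i _ => ?_
    push_cast; ring
  have hfφ : ∀ u, ∑ i, f i * (φ u i : ℤ) = 0 := by
    intro u
    rw [hlin]
    refine Finset.sum_eq_zero fun e _ => ?_
    rw [((hG _).mp e.2).2, zero_mul]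
  -- The inequality becomes an equation in the multiplicities of the generators and a slack variable
  -- `none` with coefficient -1. The bound for one equation is applied a second time to it; `φ`
  -- forgets the slack.
  let w : Option G → ℤ := fun o => o.elim (-1) fun e => ∑ i, g i * ((e : Fin n → ℕ) i : ℤ)
  let C₂ : ℕ := C + n * C * B + 1
  have hw : ∀ o, |w o| ≤ C₂ := by
    rintro (_ | e)
    · simp [w, C₂]; positivity
    · have := abs_sum_mul_le g C B hg e ((hG _).mp e.2).1
      rw [Fintype.card_fin] at this
      refine this.trans ?_
      simp only [C₂]; push_cast; linarith [(by positivity : (0 : ℤ) ≤ C)]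
  have hwφ : ∀ u : Option G → ℕ, ∑ o, w o * u o = ∑ i, g i * (φ u i : ℤ) - u none := by
    intro u
    rw [Fintype.sum_option, hlin]
    simp [w]; ring
  have hc₂ : |c' + ∑ i, g i * z₁ i| ≤ C₂ := by
    refine (abs_add_le _ _).trans ?_
    have := abs_sum_mul_le g C B hg z₁ hz₁
    rw [Fintype.card_fin] at this
    simp only [C₂]; push_cast at this ⊢; linarith
  -- The slack is the value of the left side of the inequality, so `toNat` changes nothing.
  let u : Option G → ℕ := fun o => o.elim
    (c' + ∑ i, g i * ((z₁ + ∑ e : G, m e • (e : Fin n → ℕ)) i : ℤ)).toNat m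
  have hu : φ u = ∑ e : G, m e • (e : Fin n → ℕ) := rfl
  have hu0 : (u none : ℤ) = c' + ∑ i, g i * ((z₁ + ∑ e : G, m e • (e : Fin n → ℕ)) i : ℤ) :=
    Int.toNat_of_nonneg (by exact_mod_cast hz')
  have hequ : (c' + ∑ i, g i * z₁ i) + ∑ o, w o * u o = 0 := by
    rw [hwφ, hu0, ← hu]
    simp only [Pi.add_apply, Nat.cast_add, mul_add, Finset.sum_add_distrib]; ring
  obtain ⟨u₀, v, huv, hu₀, hcu₀, hv⟩ := exists_bounded_add_closure w _ C₂ hw hc₂ u hequ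
  have hcard : Fintype.card (Option G) ≤ (B + 1) ^ n + 1 := by
    simp only [Fintype.card_option, Fintype.card_coe]; omega
  have hbound : ∀ u : Option G → ℕ, (∀ o, u o ≤ eqBound (Fintype.card (Option G)) C₂) →
      ∀ i, φ u i ≤ (B + 1) ^ n * (eqBound ((B + 1) ^ n + 1) C₂ * B) := by
    intro u hu i
    rw [hφi]
    calc _ ≤ ∑ _e : G, eqBound ((B + 1) ^ n + 1) C₂ * B := by
          refine Finset.sum_le_sum fun e _ => Nat.mul_le_mul ((hu _).trans ?_) (((hG _).mp e.2).1 i)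
          unfold eqBound
          gcongr
      _ ≤ _ := by
          rw [Finset.sum_const, smul_eq_mul]
          exact Nat.mul_le_mul_right _ (by simpa using hGcard)
  have hclos : φ v ∈ AddSubmonoid.closure M := by
    have : φ v ∈ (AddSubmonoid.closure {e : Option G → ℕ |
      (∀ i, e i ≤ eqBound (Fintype.card (Option G)) C₂) ∧ ∑ i, w i * e i = 0}).map φ :=
        AddSubmonoid.mem_map_of_mem φ hv
    rw [AddMonoidHom.map_mclosure] at this
    refine AddSubmonoid.closure_mono ?_ this
    rintro _ ⟨e, ⟨he, hew⟩, rfl⟩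
    refine ⟨fun i => (hbound e he i).trans (Nat.le_add_left _ _), hfφ e, ?_⟩
    rw [hwφ] at hew
    have : (0 : ℤ) ≤ e none := by positivity
    linarith
  refine ⟨z₁ + φ u₀, φ v, ?_, ?_, ?_, ?_, hclos⟩
  · rw [add_assoc, ← map_add, ← huv, hu]
  · exact fun i => Nat.add_le_add (hz₁ i) (hbound u₀ hu₀ i)
  · simp only [Pi.add_apply, Nat.cast_add, mul_add, Finset.sum_add_distrib, hfφ]; simpa using hcz₁
  · rw [hwφ] at hcu₀
    have : (0 : ℤ) ≤ u₀ none := by positivity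
    simp only [Pi.add_apply, Nat.cast_add, mul_add, Finset.sum_add_distrib]; linarith

end ThreeMon

/-! ### From exponents at each prime to integer points. -/

namespace ThreeMon

theorem natAbs_eq_prod_pow_padicValInt {x : ℤ} (hx : x ≠ 0) {S : Finset ℕ} (hS : ∀ p ∈ S, p.Prime)
    (h : x.natAbs.primeFactors ⊆ S) : x.natAbs = ∏ p ∈ S, p ^ padicValInt p x := by
  conv_lhs => rw [← Nat.prod_factorization_pow_eq_self (Int.natAbs_ne_zero.mpr hx)]
  rw [Finsupp.prod_of_support_subset _ (by simpa using h) _ (by simp)]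
  exact Finset.prod_congr rfl fun p hp => by rw [Nat.factorization_def _ (hS p hp)]; rfl

/-- If the exponents of every prime in the entries of `x` are a bounded vector plus a combination
of the vectors `e k`, then `x` is a bounded vector times a product of powers with the exponent
vectors `e k`. -/
theorem exists_eq_mul_prod_pow {κ : Type*} [Fintype κ] {n : ℕ} (e : κ → Fin n → ℕ) {a : ℕ} (ha : a ≠ 0)
    (B : ℕ) (x : Fin n → ℤ)
    (h : ∀ p : ℕ, p.Prime → ∃ (z₀ : Fin n → ℕ) (m : κ → ℕ), (∀ i, z₀ i ≤ B) ∧ (¬ p ∣ a → z₀ = 0) ∧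
      ∀ i, padicValInt p (x i) = z₀ i + ∑ k, m k * e k i) :
    ∃ (x₀ : Fin n → ℤ) (U : κ → ℤ), (∀ k, U k ≠ 0) ∧ (∀ i, x₀ i = 0 ↔ x i = 0) ∧
      (∀ i, |x₀ i| ≤ a ^ B) ∧ ∀ i, x i = x₀ i * ∏ k, U k ^ e k i := by
  choose! z₀ m hB ha0 hx using h
  let S : Finset ℕ := a.primeFactors ∪ Finset.univ.biUnion fun i => (x i).natAbs.primeFactors
  have hS : ∀ p ∈ S, p.Prime := by
    intro p hp
    simp only [S, Finset.mem_union, Finset.mem_biUnion, Nat.mem_primeFactors] at hp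
    rcases hp with hp | ⟨i, -, hp⟩ <;> exact hp.1
  -- Only the primes that divide `a` contribute to `x₀`, which keeps it bounded. The sign makes `x₀`
  -- vanish exactly where `x` does, so it does not matter that the valuation of 0 is set to 0.
  refine ⟨fun i => (x i).sign * ∏ p ∈ a.primeFactors, (p : ℤ) ^ z₀ p i,
    fun k => ∏ p ∈ S, (p : ℤ) ^ m p k, ?_, ?_, ?_, ?_⟩
  · exact fun k => Finset.prod_ne_zero_iff.mpr fun p hp =>
      pow_ne_zero _ (by exact_mod_cast (hS p hp).ne_zero)
  · intro i
    have : ∏ p ∈ a.primeFactors, (p : ℤ) ^ z₀ p i ≠ 0 := Finset.prod_ne_zero_iff.mpr fun p hp =>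
      pow_ne_zero _ (by exact_mod_cast (Nat.prime_of_mem_primeFactors hp).ne_zero)
    simp [this]
  · intro i
    have h1 : (∏ p ∈ a.primeFactors, p ^ z₀ p i) ≤ a ^ B := by
      calc _ ≤ ∏ p ∈ a.primeFactors, p ^ B := Finset.prod_le_prod' fun p hp =>
            Nat.pow_le_pow_right (Nat.prime_of_mem_primeFactors hp).pos
              (hB p (Nat.prime_of_mem_primeFactors hp) i)
        _ = (∏ p ∈ a.primeFactors, p) ^ B := Finset.prod_pow _ _ _
        _ ≤ a ^ B := Nat.pow_le_pow_left
              (Nat.le_of_dvd (Nat.pos_of_ne_zero ha) (Nat.prod_primeFactors_dvd a)) _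
    rw [abs_mul]
    have h2 : |(x i).sign| ≤ 1 := by
      rcases lt_trichotomy (x i) 0 with h | h | h
      · simp [Int.sign_eq_neg_one_of_neg h]
      · simp [h]
      · simp [Int.sign_eq_one_of_pos h]
    have h3 : |∏ p ∈ a.primeFactors, (p : ℤ) ^ z₀ p i| ≤ a ^ B := by
      rw [abs_of_nonneg (by positivity)]; exact_mod_cast h1
    calc _ ≤ 1 * (a ^ B : ℤ) := mul_le_mul h2 h3 (abs_nonneg _) zero_le_one
      _ = _ := one_mul _
  · intro i
    by_cases h0 : x i = 0
    · simp [h0]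
    have h1 := natAbs_eq_prod_pow_padicValInt h0 hS
      (fun p hp => Finset.mem_union_right _ (Finset.mem_biUnion.mpr ⟨i, Finset.mem_univ _, hp⟩))
    have h2 : ∏ p ∈ a.primeFactors, p ^ z₀ p i = ∏ p ∈ S, p ^ z₀ p i := by
      refine Finset.prod_subset Finset.subset_union_left fun p hp hpa => ?_
      have : ¬ p ∣ a := fun hd => hpa (Nat.mem_primeFactors.mpr ⟨hS p hp, hd, ha⟩)
      simp [ha0 p (hS p hp) this]
    have h3 : (x i).natAbs = (∏ p ∈ a.primeFactors, p ^ z₀ p i) *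
        ∏ k, (∏ p ∈ S, p ^ m p k) ^ e k i := by
      rw [h1, h2]
      simp only [← Finset.prod_pow]
      rw [Finset.prod_comm, ← Finset.prod_mul_distrib]
      refine Finset.prod_congr rfl fun p hp => ?_
      simp only [← pow_mul]
      rw [hx p (hS p hp) i, pow_add, Finset.prod_pow_eq_pow_sum]
    conv_lhs => rw [← Int.sign_mul_natAbs (x i), h3]
    push_cast
    ring

theorem padicValInt_prod_pow (p : ℕ) [Fact p.Prime] {n : ℕ} (a : ℤ) (x : Fin n → ℤ) (e : Fin n → ℕ)
    (h : a * ∏ i, x i ^ e i ≠ 0) :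
    padicValInt p (a * ∏ i, x i ^ e i) = padicValInt p a + ∑ i, e i * padicValInt p (x i) := by
  have ha := left_ne_zero_of_mul h
  have hp := right_ne_zero_of_mul h
  rw [padicValInt.mul ha hp]
  congr 1
  have : ∀ s : Finset (Fin n), (∏ i ∈ s, x i ^ e i ≠ 0) →
      padicValInt p (∏ i ∈ s, x i ^ e i) = ∑ i ∈ s, e i * padicValInt p (x i) := by
    intro s
    induction s using Finset.induction_on with
    | empty => simp [padicValInt]
    | insert i s hi ih =>
      intro h
      rw [Finset.prod_insert hi] at h ⊢
      rw [padicValInt.mul (left_ne_zero_of_mul h) (right_ne_zero_of_mul h), Finset.sum_insert hi,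
        ih (right_ne_zero_of_mul h)]
      congr 1
      rw [padicValInt, Int.natAbs_pow, padicValNat.pow]; rfl
  exact this _ hp

/-- If three integers have the sum zero, then for every prime the least exponent occurs twice. -/
theorem padicValInt_eq_of_add_eq_zero (p : ℕ) [hp : Fact p.Prime] {a b c : ℤ} (ha : a ≠ 0)
    (hb : b ≠ 0) (hc : c ≠ 0) (h : a + b + c = 0) :
    (padicValInt p a = padicValInt p b ∧ padicValInt p a ≤ padicValInt p c) ∨
    (padicValInt p b = padicValInt p c ∧ padicValInt p b ≤ padicValInt p a) ∨
    (padicValInt p a = padicValInt p c ∧ padicValInt p a ≤ padicValInt p b) := by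
  -- The ultrametric inequality, used for each of the three integers against the two others.
  have key : ∀ a b c : ℤ, a ≠ 0 → a + b + c = 0 → b ≠ 0 → c ≠ 0 →
      min (padicValInt p b) (padicValInt p c) ≤ padicValInt p a := by
    intro a b c ha h hb hc
    have h1 : (p : ℤ) ^ min (padicValInt p b) (padicValInt p c) ∣ a := by
      have : a = -(b + c) := by linarith
      rw [this, dvd_neg]
      exact dvd_add ((pow_dvd_pow _ (min_le_left _ _)).trans (padicValInt_dvd b))
        ((pow_dvd_pow _ (min_le_right _ _)).trans (padicValInt_dvd c))
    exact (padicValInt_dvd_iff _ _).mp h1 |>.resolve_left ha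
  have h1 := key a b c ha h hb hc
  have h2 := key b c a hb (by linarith) hc ha
  have h3 := key c a b hc (by linarith) ha hb
  omega

end ThreeMon

/-! ### Evaluation of expressions, and parametric families solved for one linear variable. -/

namespace ThreeMon

namespace Expr

theorem eval_add {u : List ℤ} {a b : Expr} {x y : ℚ} (ha : a.eval u = some x) (hb : b.eval u = some y) :
    (add a b).eval u = some (x + y) := by simp [eval, ha, hb]

theorem eval_mul {u : List ℤ} {a b : Expr} {x y : ℚ} (ha : a.eval u = some x) (hb : b.eval u = some y) :
    (mul a b).eval u = some (x * y) := by simp [eval, ha, hb]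

theorem eval_div {u : List ℤ} {a b : Expr} {x y : ℚ} (ha : a.eval u = some x) (hb : b.eval u = some y)
    (hy : y ≠ 0) : (div a b).eval u = some (x / y) := by simp [eval, ha, hb, hy]

theorem eval_pow {u : List ℤ} {a : Expr} {x : ℚ} (k : ℕ) (ha : a.eval u = some x) :
    (pow a k).eval u = some (x ^ k) := by simp [eval, ha]

theorem eval_var {u : List ℤ} {i : ℕ} (hi : i < u.length) :
    (var i).eval u = some ((u.getD i 0 : ℤ) : ℚ) := by simp [eval, hi]

/-- The product of the expressions `f k` for `k < K`. -/
def prodRange (f : ℕ → Expr) (K : ℕ) : Expr := Nat.rec (const 1) (fun k e => mul e (f k)) K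

theorem eval_prodRange {u : List ℤ} {f : ℕ → Expr} {q : ℕ → ℚ} {K : ℕ}
    (h : ∀ k < K, (f k).eval u = some (q k)) :
    (prodRange f K).eval u = some (∏ k ∈ Finset.range K, q k) := by
  induction K with
  | zero => simp [prodRange, eval]
  | succ K ih =>
    rw [Finset.prod_range_succ]
    exact eval_mul (ih fun k hk => h k (by omega)) (h K (by omega))

end Expr

/-- The range of a parameter involves only earlier ones, so admissibility can be treated by
induction on the number of parameters. -/
theorem admissible_concat (rs : List ParamRange) (r : ParamRange) (u : List ℤ) :
    Admissible (rs ++ [r]) u ↔ ∃ u' z, u = u' ++ [z] ∧ Admissible rs u' ∧ r.Contains u' z := by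
  constructor
  · rintro ⟨hl, h⟩
    rw [List.length_append, List.length_singleton] at hl
    have hne : u ≠ [] := by rintro rfl; simp at hl
    obtain ⟨u', z, rfl⟩ : ∃ u' z, u = u' ++ [z] := ⟨_, _, (List.dropLast_append_getLast hne).symm⟩
    have hl' : u'.length = rs.length := by simpa using hl
    refine ⟨u', z, rfl, ⟨hl', fun i s y hs hy => ?_⟩, ?_⟩
    · have h1 : i < rs.length := (List.getElem?_eq_some_iff.mp hs).1
      have := h i s y (by rw [List.getElem?_append_left h1, hs])
        (by rw [List.getElem?_append_left (hl' ▸ h1), hy])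
      rwa [List.take_append_of_le_length (by omega)] at this
    · have := h rs.length r z (by simp) (by simp [← hl'])
      rwa [← hl', List.take_left] at this
  · rintro ⟨u', z, rfl, ⟨hl, h⟩, hz⟩
    refine ⟨by simp [hl], fun i s y hs hy => ?_⟩
    rcases lt_trichotomy i rs.length with h1 | rfl | h1
    · rw [List.getElem?_append_left h1] at hs
      rw [List.getElem?_append_left (hl ▸ h1)] at hy
      rw [List.take_append_of_le_length (by omega)]
      exact h i s y hs hy
    · rw [← hl] at hy ⊢
      simp only [List.getElem?_concat_length, Option.some.injEq] at hs hy
      subst hs hy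
      rwa [List.take_left]
    · have := (List.getElem?_eq_some_iff.mp hs).1
      simp at this; omega

/-- Data for a parametric family. In `((A, B, C), us, vs, x, z)` the list `us` describes parameters
`tₖ` that are free, where the entry `(r, (b, c), e)` stands for `U = A t + r`, and the list `vs`
describes parameters `S ≠ 0` restricted by divisibility, with entries `(d, e)`. With
`W = (B ∏ U ^ b + C ∏ U ^ c) / (A ∏ S ^ d)` the coordinates of the point are
`xᵢ ∏ U ^ eᵢ ∏ S ^ eᵢ W ^ zᵢ`. -/
abbrev Spec : Type :=
  (ℤ × ℤ × ℤ) × List (ℤ × (ℕ × ℕ) × List ℕ) × List (ℕ × List ℕ) × List ℤ × List ℕ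

namespace Spec

def lead (S : Spec) : ℤ := S.1.1
def numFree (S : Spec) : ℕ := S.2.1.length
def numDiv (S : Spec) : ℕ := S.2.2.1.length
def freeData (S : Spec) (k : ℕ) : ℤ × (ℕ × ℕ) × List ℕ := S.2.1.getD k (0, (0, 0), [])
def divData (S : Spec) (k : ℕ) : ℕ × List ℕ := S.2.2.1.getD k (0, [])
def base (S : Spec) (i : ℕ) : ℤ := S.2.2.2.1.getD i 0
def baseExp (S : Spec) (i : ℕ) : ℕ := S.2.2.2.2.getD i 0

def freeExpr (S : Spec) (k : ℕ) : Expr :=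
  .add (.mul (.const S.lead) (.var k)) (.const (S.freeData k).1)

def numExpr (S : Spec) : Expr :=
  .add
    (.mul (.const S.1.2.1) (.prodRange (fun k => .pow (S.freeExpr k) (S.freeData k).2.1.1) S.numFree))
    (.mul (.const S.1.2.2) (.prodRange (fun k => .pow (S.freeExpr k) (S.freeData k).2.1.2) S.numFree))

def denExpr (S : Spec) (k : ℕ) : Expr :=
  .mul (.const S.lead) (.prodRange (fun l => .pow (.var (S.numFree + l)) (S.divData l).1) k)

/-- This plays two roles: it is the integer whose divisors restrict the parameter `S_k`, and, when
all restricted parameters are used, it is `W`. -/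
def quotExpr (S : Spec) (k : ℕ) : Expr := .div S.numExpr (S.denExpr k)

def coordExpr (S : Spec) (i : ℕ) : Expr :=
  .mul
    (.mul (.const (S.base i))
      (.prodRange (fun k => .pow (S.freeExpr k) ((S.freeData k).2.2.getD i 0)) S.numFree))
    (.mul (.prodRange (fun k => .pow (.var (S.numFree + k)) ((S.divData k).2.getD i 0)) S.numDiv)
      (.pow (S.quotExpr S.numDiv) (S.baseExp i)))

/-- The ranges of the free parameters and of the first `K` other parameters. -/
def ranges (S : Spec) (K : ℕ) : List ParamRange :=
  (List.range S.numFree).map (fun _ => (false, [])) ++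
    (List.range K).map fun k => (true, [((S.divData k).1, S.quotExpr k)])

def family (S : Spec) : Family :=
  (S.ranges S.numDiv, (List.range S.2.2.2.1.length).map S.coordExpr)

/-- These are the integer values of the expressions. Parameters are read from a total function `v`,
the free ones first and the restricted ones from the index `numFree` on. -/
def free (S : Spec) (v : ℕ → ℤ) (k : ℕ) : ℤ := S.lead * v k + (S.freeData k).1

def num (S : Spec) (v : ℕ → ℤ) : ℤ :=
  S.1.2.1 * ∏ k ∈ Finset.range S.numFree, S.free v k ^ (S.freeData k).2.1.1 +
    S.1.2.2 * ∏ k ∈ Finset.range S.numFree, S.free v k ^ (S.freeData k).2.1.2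

def den (S : Spec) (v : ℕ → ℤ) (K : ℕ) : ℤ :=
  S.lead * ∏ l ∈ Finset.range K, v (S.numFree + l) ^ (S.divData l).1

/-- The residues of the free parameters make the numerator divisible by the leading coefficient. -/
def Valid (S : Spec) : Prop :=
  S.lead ≠ 0 ∧ S.lead ∣
    S.1.2.1 * ∏ k ∈ Finset.range S.numFree, (S.freeData k).1 ^ (S.freeData k).2.1.1 +
      S.1.2.2 * ∏ k ∈ Finset.range S.numFree, (S.freeData k).1 ^ (S.freeData k).2.1.2

variable {S : Spec}

/-- Modulo `A` each `U = A t + r` may be replaced by its residue, so divisibility of the numerator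
by `A` is a property of the residues alone. -/
theorem num_modEq (S : Spec) (v : ℕ → ℤ) : S.num v ≡
    S.1.2.1 * ∏ k ∈ Finset.range S.numFree, (S.freeData k).1 ^ (S.freeData k).2.1.1 +
      S.1.2.2 * ∏ k ∈ Finset.range S.numFree, (S.freeData k).1 ^ (S.freeData k).2.1.2
    [ZMOD S.lead] := by
  have h : ∀ k, S.free v k ≡ (S.freeData k).1 [ZMOD S.lead] := fun k => by
    simp [free, Int.ModEq]
  have h2 : ∀ f : ℕ → ℕ, ∏ k ∈ Finset.range S.numFree, S.free v k ^ f k ≡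
      ∏ k ∈ Finset.range S.numFree, (S.freeData k).1 ^ f k [ZMOD S.lead] := fun f =>
    Int.ModEq.prod fun k _ => (h k).pow _
  exact ((h2 _).mul_left _).add ((h2 _).mul_left _)

theorem Valid.lead_dvd_num (hS : S.Valid) (v : ℕ → ℤ) : S.lead ∣ S.num v :=
  (S.num_modEq v).dvd_iff.mpr hS.2

theorem eval_freeExpr {u : List ℤ} {k : ℕ} (hk : k < u.length) :
    (S.freeExpr k).eval u = some ((S.free (fun i => u.getD i 0) k : ℤ) : ℚ) := by
  simpa [free, freeExpr] using Expr.eval_add (Expr.eval_mul (by rfl) (Expr.eval_var hk)) (by rfl)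

theorem eval_freeProd {u : List ℤ} (hu : S.numFree ≤ u.length) (f : ℕ → ℕ) :
    (Expr.prodRange (fun k => .pow (S.freeExpr k) (f k)) S.numFree).eval u =
      some (((∏ k ∈ Finset.range S.numFree, S.free (fun i => u.getD i 0) k ^ f k : ℤ)) : ℚ) := by
  push_cast
  exact Expr.eval_prodRange fun k hk => Expr.eval_pow _ (eval_freeExpr (by omega))

theorem eval_divProd {u : List ℤ} {K : ℕ} (hu : S.numFree + K ≤ u.length) (f : ℕ → ℕ) :
    (Expr.prodRange (fun k => .pow (.var (S.numFree + k)) (f k)) K).eval u =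
      some (((∏ k ∈ Finset.range K, u.getD (S.numFree + k) 0 ^ f k : ℤ)) : ℚ) := by
  push_cast
  exact Expr.eval_prodRange fun k hk => Expr.eval_pow _ (Expr.eval_var (by omega))

theorem eval_numExpr {u : List ℤ} (hu : S.numFree ≤ u.length) :
    S.numExpr.eval u = some ((S.num (fun i => u.getD i 0) : ℤ) : ℚ) := by
  have := Expr.eval_add
    (Expr.eval_mul (a := .const S.1.2.1) (by rfl) (eval_freeProd hu fun k => (S.freeData k).2.1.1))
    (Expr.eval_mul (a := .const S.1.2.2) (by rfl) (eval_freeProd hu fun k => (S.freeData k).2.1.2))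
  rw [numExpr, this, num]; push_cast; rfl

theorem den_ne_zero (hS : S.Valid) {v : ℕ → ℤ} {K : ℕ} (h : ∀ l < K, v (S.numFree + l) ≠ 0) :
    S.den v K ≠ 0 :=
  mul_ne_zero hS.1 (Finset.prod_ne_zero_iff.mpr fun l hl => pow_ne_zero _ (h l (by simpa using hl)))

theorem eval_quotExpr (hS : S.Valid) {u : List ℤ} {K : ℕ} (hu : S.numFree + K ≤ u.length)
    (h : ∀ l < K, u.getD (S.numFree + l) 0 ≠ 0) {W : ℤ}
    (hW : S.num (fun i => u.getD i 0) = S.den (fun i => u.getD i 0) K * W) :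
    (S.quotExpr K).eval u = some (W : ℚ) := by
  have hd : (S.denExpr K).eval u = some ((S.den (fun i => u.getD i 0) K : ℤ) : ℚ) := by
    have := Expr.eval_mul (a := .const S.lead) (by rfl) (eval_divProd hu fun l => (S.divData l).1)
    rw [denExpr, this, den]; push_cast; rfl
  have h0 : ((S.den (fun i => u.getD i 0) K : ℤ) : ℚ) ≠ 0 := by
    exact_mod_cast den_ne_zero hS h
  rw [quotExpr, Expr.eval_div (eval_numExpr (by omega)) hd h0, hW]
  push_cast
  rw [mul_div_cancel_left₀ _ h0]

theorem num_congr {v v' : ℕ → ℤ} (h : ∀ i < S.numFree, v i = v' i) : S.num v = S.num v' := by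
  have h2 : ∀ f : ℕ → ℕ, ∏ k ∈ Finset.range S.numFree, S.free v k ^ f k =
      ∏ k ∈ Finset.range S.numFree, S.free v' k ^ f k := fun f =>
    Finset.prod_congr rfl fun k hk => by rw [free, free, h k (by simpa using hk)]
  rw [num, num, h2, h2]

theorem den_congr {v v' : ℕ → ℤ} {K : ℕ} (h : ∀ l < K, v (S.numFree + l) = v' (S.numFree + l)) :
    S.den v K = S.den v' K := by
  rw [den, den]
  congr 1
  exact Finset.prod_congr rfl fun k hk => by rw [h k (by simpa using hk)]

theorem den_succ (v : ℕ → ℤ) (K : ℕ) :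
    S.den v (K + 1) = S.den v K * v (S.numFree + K) ^ (S.divData K).1 := by
  rw [den, den, Finset.prod_range_succ, mul_assoc]

theorem ranges_succ (S : Spec) (K : ℕ) :
    S.ranges (K + 1) = S.ranges K ++ [(true, [((S.divData K).1, S.quotExpr K)])] := by
  simp [ranges, List.range_succ]

/-- The successive divisibilities telescope: if the numerator is `den K * W`, then `S_K ^ d ∣ W`
means that `den (K + 1)` divides the numerator, since `den K ≠ 0`. The start `K = 0` is the validity
of the residues. -/
theorem admissible_ranges_iff (hS : S.Valid) (K : ℕ) (u : List ℤ) :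
    Admissible (S.ranges K) u ↔ u.length = S.numFree + K ∧
      (∀ l < K, u.getD (S.numFree + l) 0 ≠ 0) ∧
      S.den (fun i => u.getD i 0) K ∣ S.num (fun i => u.getD i 0) := by
  induction K generalizing u with
  | zero =>
    have : S.den (fun i => u.getD i 0) 0 ∣ S.num (fun i => u.getD i 0) := by
      simpa [den] using hS.lead_dvd_num _
    simp only [this, not_lt_zero, false_implies, implies_true, and_true]
    refine ⟨fun h => by simpa [ranges] using h.1, fun h => ⟨by simpa [ranges] using h, ?_⟩⟩
    intro i r z hr _
    simp only [ranges, List.range_zero, List.map_nil, List.append_nil, List.getElem?_map,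
      Option.map_eq_some_iff] at hr
    obtain ⟨_, _, rfl⟩ := hr
    simp [ParamRange.Contains]
  | succ K ih =>
    rw [ranges_succ, admissible_concat]
    have key : ∀ (u' : List ℤ) (z : ℤ), u'.length = S.numFree + K →
        (∀ i < S.numFree + K, (u' ++ [z]).getD i 0 = u'.getD i 0) ∧
        (u' ++ [z]).getD (S.numFree + K) 0 = z := by
      intro u' z hl
      refine ⟨fun i hi => ?_, ?_⟩
      · rw [List.getD_append _ _ _ _ (by omega)]
      · rw [List.getD_append_right _ _ _ _ (by omega)]; simp [hl]
    have key2 : ∀ (u' : List ℤ) (z : ℤ), u'.length = S.numFree + K →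
        S.num (fun i => (u' ++ [z]).getD i 0) = S.num (fun i => u'.getD i 0) ∧
        S.den (fun i => (u' ++ [z]).getD i 0) (K + 1) =
          S.den (fun i => u'.getD i 0) K * z ^ (S.divData K).1 := by
      intro u' z hl
      obtain ⟨h1, h2⟩ := key u' z hl
      refine ⟨num_congr fun i hi => h1 i (by omega), ?_⟩
      rw [den_succ, h2, den_congr (v' := fun i => u'.getD i 0) fun l hl => h1 (S.numFree + l) (by omega)]
    constructor
    · rintro ⟨u', z, rfl, hu', hz⟩
      obtain ⟨hl, hne, W, hW⟩ := (ih u').mp hu'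
      obtain ⟨h1, h2⟩ := key u' z hl
      obtain ⟨h3, h4⟩ := key2 u' z hl
      obtain ⟨hz0, hzd⟩ := hz
      obtain ⟨m, hm, hzm⟩ := hzd ((S.divData K).1, S.quotExpr K) (by simp)
      rw [eval_quotExpr hS hl.ge hne hW] at hm
      obtain rfl : W = m := by simpa using hm
      refine ⟨by simp [hl]; omega, fun l hlK => ?_, ?_⟩
      · rcases Nat.lt_succ_iff_lt_or_eq.mp hlK with h | rfl
        · rw [h1 _ (by omega)]; exact hne l h
        · rw [h2]; exact hz0 rfl
      · rw [h3, h4, hW]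
        exact mul_dvd_mul_left _ hzm
    · rintro ⟨hl, hne, hdvd⟩
      have hnil : u ≠ [] := by rintro rfl; simp at hl
      obtain ⟨u', z, rfl⟩ : ∃ u' z, u = u' ++ [z] := ⟨_, _, (List.dropLast_append_getLast hnil).symm⟩
      have hl : u'.length = S.numFree + K := by simp at hl; omega
      obtain ⟨h1, h2⟩ := key u' z hl
      obtain ⟨h3, h4⟩ := key2 u' z hl
      have hne' : ∀ l < K, u'.getD (S.numFree + l) 0 ≠ 0 := fun l hlK => by
        rw [← h1 _ (by omega)]; exact hne l (by omega)
      rw [h3, h4] at hdvd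
      obtain ⟨W, hW⟩ := (dvd_mul_right _ _).trans hdvd
      refine ⟨u', z, rfl, (ih u').mpr ⟨hl, hne', W, hW⟩, fun _ => ?_, ?_⟩
      · rw [← h2]; exact hne K (by omega)
      · intro q hq
        obtain rfl : q = ((S.divData K).1, S.quotExpr K) := by simpa using hq
        refine ⟨W, eval_quotExpr hS hl.ge hne' hW, ?_⟩
        rw [hW] at hdvd
        exact Int.dvd_of_mul_dvd_mul_left (den_ne_zero hS hne') hdvd

/-- The coordinates of the point of the family with the parameters `v` and the quotient `W`. -/
def coord (S : Spec) (v : ℕ → ℤ) (W : ℤ) (i : ℕ) : ℤ :=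
  S.base i * (∏ k ∈ Finset.range S.numFree, S.free v k ^ (S.freeData k).2.2.getD i 0) *
    ((∏ k ∈ Finset.range S.numDiv, v (S.numFree + k) ^ (S.divData k).2.getD i 0) * W ^ S.baseExp i)

theorem eval_coordExpr (hS : S.Valid) {u : List ℤ} (hu : S.numFree + S.numDiv ≤ u.length)
    (h : ∀ l < S.numDiv, u.getD (S.numFree + l) 0 ≠ 0) {W : ℤ}
    (hW : S.num (fun i => u.getD i 0) = S.den (fun i => u.getD i 0) S.numDiv * W) (i : ℕ) :
    (S.coordExpr i).eval u = some ((S.coord (fun i => u.getD i 0) W i : ℤ) : ℚ) := by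
  have := Expr.eval_mul
    (Expr.eval_mul (a := .const (S.base i)) (by rfl)
      (eval_freeProd (S := S) (by omega) fun k => (S.freeData k).2.2.getD i 0))
    (Expr.eval_mul (eval_divProd (S := S) hu fun k => (S.divData k).2.getD i 0)
      (Expr.eval_pow (S.baseExp i) (eval_quotExpr hS hu h hW)))
  rw [coordExpr, this, coord]; push_cast; rfl

theorem family_wellDefined (hS : S.Valid) : S.family.WellDefined S.2.2.2.1.length := by
  refine ⟨fun i r hr u hu q hq => ?_, by simp [family], fun u hu e he => ?_⟩
  · simp only [family] at hr hu
    rcases lt_or_ge i S.numFree with hi | hi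
    · rw [ranges, List.getElem?_append_left (by simpa using hi)] at hr
      simp only [List.getElem?_map, Option.map_eq_some_iff] at hr
      obtain ⟨_, _, rfl⟩ := hr
      simp at hq
    · obtain ⟨K, rfl⟩ := Nat.exists_eq_add_of_le hi
      have hr' := hr
      rw [ranges, List.getElem?_append_right (by simp)] at hr
      simp only [List.length_map, List.length_range, Nat.add_sub_cancel_left, List.getElem?_map,
        Option.map_eq_some_iff] at hr
      obtain ⟨K', hK', rfl⟩ := hr
      obtain ⟨hK, hK'⟩ := List.getElem?_eq_some_iff.mp hK'
      rw [List.length_range] at hK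
      simp only [List.getElem_range] at hK'
      subst hK'
      have htake : (S.ranges S.numDiv).take (S.numFree + K) = S.ranges K := by
        rw [ranges, List.take_append, List.take_of_length_le (by simp), ranges]
        simp [List.take_range, hK.le, ← List.map_take]
      rw [htake, admissible_ranges_iff hS] at hu
      obtain ⟨hl, hne, W, hW⟩ := hu
      obtain rfl : q = ((S.divData K).1, S.quotExpr K) := by simpa using hq
      exact ⟨W, eval_quotExpr hS hl.ge hne hW⟩
  · obtain ⟨hl, hne, W, hW⟩ := (admissible_ranges_iff hS _ u).mp hu
    simp only [family, List.mem_map] at he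
    obtain ⟨i, _, rfl⟩ := he
    exact ⟨_, eval_coordExpr hS hl.ge hne hW i⟩

/-- This eliminates division: `W` becomes an integer with `num = den * W`, and points of the family
can be treated by polynomial identities. -/
theorem mem_family_points (hS : S.Valid) {n : ℕ} (hn : n = S.2.2.2.1.length) (x : Fin n → ℤ) :
    x ∈ S.family.points n ↔ ∃ (v : ℕ → ℤ) (W : ℤ), (∀ l < S.numDiv, v (S.numFree + l) ≠ 0) ∧
      S.num v = S.den v S.numDiv * W ∧ ∀ i, x i = S.coord v W i := by
  subst hn
  have key : ∀ {u : List ℤ} {W : ℤ}, S.numFree + S.numDiv ≤ u.length →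
      (∀ l < S.numDiv, u.getD (S.numFree + l) 0 ≠ 0) →
      S.num (fun i => u.getD i 0) = S.den (fun i => u.getD i 0) S.numDiv * W →
      (S.family.2.map (fun e => e.eval u) = (List.ofFn fun i => some (x i : ℚ)) ↔
        ∀ i, x i = S.coord (fun i => u.getD i 0) W i) := by
    intro u W hl hne hW
    have : S.family.2.map (fun e => e.eval u) =
        List.ofFn fun i : Fin S.2.2.2.1.length => some ((S.coord (fun i => u.getD i 0) W i : ℤ) : ℚ) := by
      apply List.ext_getElem
      · simp [family]
      · intro i h1 h2
        simp [family, eval_coordExpr hS hl hne hW]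
    rw [this, List.ofFn_inj, funext_iff]
    exact forall_congr' fun i => by
      simp only [Option.some.injEq, Int.cast_inj]
      exact eq_comm
  constructor
  · rintro ⟨u, hu, hx⟩
    obtain ⟨hl, hne, W, hW⟩ := (admissible_ranges_iff hS _ u).mp hu
    exact ⟨_, W, hne, hW, (key hl.ge hne hW).mp hx⟩
  · rintro ⟨v, W, hne, hW, hx⟩
    set u := List.ofFn fun i : Fin (S.numFree + S.numDiv) => v i with hu
    have hl : u.length = S.numFree + S.numDiv := by simp [u]
    have hv : ∀ i < S.numFree + S.numDiv, u.getD i 0 = v i := by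
      intro i hi
      rw [List.getD_eq_getElem _ _ (by omega)]
      simp [u]
    have hnum : S.num (fun i => u.getD i 0) = S.num v := num_congr fun i hi => hv i (by omega)
    have hden : S.den (fun i => u.getD i 0) S.numDiv = S.den v S.numDiv :=
      den_congr fun l hl => hv _ (by omega)
    have hne' : ∀ l < S.numDiv, u.getD (S.numFree + l) 0 ≠ 0 := fun l hl => by
      rw [hv _ (by omega)]; exact hne l hl
    rw [← hnum, ← hden] at hW
    refine ⟨u, (admissible_ranges_iff hS _ u).mpr ⟨hl, hne', W, hW⟩, (key hl.ge hne' hW).mpr fun i => ?_⟩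
    rw [hx i, coord, coord]
    have h2 : ∀ f : ℕ → ℕ, ∏ k ∈ Finset.range S.numFree, S.free v k ^ f k =
        ∏ k ∈ Finset.range S.numFree, S.free (fun i => u.getD i 0) k ^ f k := fun f =>
      Finset.prod_congr rfl fun k hk => by
        rw [free, free, hv k (by have := Finset.mem_range.mp hk; omega)]
    have h3 : ∀ f : ℕ → ℕ, ∏ k ∈ Finset.range S.numDiv, v (S.numFree + k) ^ f k =
        ∏ k ∈ Finset.range S.numDiv, u.getD (S.numFree + k) 0 ^ f k := fun f =>
      Finset.prod_congr rfl fun k hk => by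
        rw [hv _ (by have := Finset.mem_range.mp hk; omega)]
    rw [h2, h3]

end Spec
end ThreeMon

/-! ### The algorithm, and the solutions for which some term vanishes. -/

namespace ThreeMon

/-- The lists of length `n` with entries from `l`. -/
def words {α : Type*} (l : List α) (n : ℕ) : List (List α) :=
  Nat.rec [[]] (fun _ w => w.flatMap fun t => l.map fun a => a :: t) n

theorem mem_words {α : Type*} {l : List α} {n : ℕ} {t : List α} :
    t ∈ words l n ↔ t.length = n ∧ ∀ a ∈ t, a ∈ l := by
  induction n generalizing t with
  | zero => simp +contextual [words]
  | succ n ih =>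
    change t ∈ (words l n).flatMap (fun t => l.map fun a => a :: t) ↔ _
    simp only [List.mem_flatMap, List.mem_map, ih]
    constructor
    · rintro ⟨s, ⟨h1, h2⟩, a, ha, rfl⟩
      exact ⟨by simp [h1], by simpa [ha] using h2⟩
    · rintro ⟨h1, h2⟩
      cases t with
      | nil => simp at h1
      | cons a s => exact ⟨s, ⟨by simpa using h1, fun b hb => h2 b (by simp [hb])⟩, a, h2 a (by simp), rfl⟩

namespace Equation

variable (E : Equation)

/-- The exponent of the variable with the number `i` in the monomial `j`. -/
def expAt (j : Fin 3) (i : ℕ) : ℕ := E.2.getD i 0 j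

/-- The weight of an exponent vector that is given as a list. -/
def listWeight (j : Fin 3) (e : List ℕ) : ℕ :=
  ∑ i ∈ Finset.range E.2.length, E.expAt j i * e.getD i 0

/-- The value of the term `j` at a point that is given as a list. -/
def termAt (j : Fin 3) (x : List ℤ) : ℤ :=
  E.coeff j * ∏ i ∈ Finset.range E.2.length, x.getD i 0 ^ E.expAt j i

/-- Chosen to exceed all exponents of the equation and, when the coefficients are non-zero, all
prime exponents in them; it serves as the constant `C` of the bounds for linear systems. -/
def size : ℕ :=
  1 + (E.coeff 0).natAbs + (E.coeff 1).natAbs + (E.coeff 2).natAbs +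
    ∑ i ∈ Finset.range E.2.length, (E.expAt 0 i + E.expAt 1 i + E.expAt 2 i)

def expBound : ℕ := sysBound E.2.length E.size

/-- The exponent vectors with bounded entries. -/
def box : List (List ℕ) := words (List.range (E.expBound + 1)) E.2.length

/-- The bound `a ^ B` of `exists_eq_mul_prod_pow`, with `a` the absolute value of the product of the
coefficients and `B = expBound`. -/
def baseBound : ℕ := ((E.coeff 0).natAbs * (E.coeff 1).natAbs * (E.coeff 2).natAbs) ^ E.expBound

/-- The integer points with bounded coordinates. -/
def basePoints : List (List ℤ) :=
  words ((List.range (2 * E.baseBound + 1)).map fun k : ℕ => (k : ℤ) - E.baseBound) E.2.length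

/-- The exponent vectors that have the same weight in all terms that do not vanish at `x`. -/
def balancedExps (x : List ℤ) : List (List ℕ) :=
  E.box.filter fun e =>
    (E.termAt 0 x = 0 ∨ E.termAt 1 x = 0 ∨ E.listWeight 0 e = E.listWeight 1 e) ∧
    (E.termAt 1 x = 0 ∨ E.termAt 2 x = 0 ∨ E.listWeight 1 e = E.listWeight 2 e) ∧
    (E.termAt 0 x = 0 ∨ E.termAt 2 x = 0 ∨ E.listWeight 0 e = E.listWeight 2 e)

/-- The exponent vectors for which the weight in the term `j` and in another term is the least. -/
def freeExps (j : Fin 3) : List (List ℕ) :=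
  E.box.filter fun e =>
    (E.listWeight j e = E.listWeight (j + 1) e ∧ E.listWeight j e ≤ E.listWeight (j + 2) e) ∨
    (E.listWeight j e = E.listWeight (j + 2) e ∧ E.listWeight j e ≤ E.listWeight (j + 1) e)

/-- The exponent vectors for which the weight in the two terms other than `j` is the least. -/
def divExps (j : Fin 3) : List (List ℕ) :=
  E.box.filter fun e =>
    E.listWeight (j + 1) e = E.listWeight (j + 2) e ∧ E.listWeight (j + 1) e ≤ E.listWeight j e

/-- The exponent vectors that show that the equation satisfies the condition. -/
def linearExps (j : Fin 3) : List (List ℕ) :=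
  E.box.filter fun e =>
    E.listWeight (j + 1) e = E.listWeight (j + 2) e ∧ E.listWeight j e = E.listWeight (j + 1) e + 1

/-- The family of the solutions obtained from a solution `x` by scaling. -/
def scalingSpec (x : List ℤ) : Spec :=
  -- With `A = 1` and residues 0 the parameters are arbitrary integers. The numerator is 0, hence `W
  -- = 0`, but the empty exponent list lets it enter only as `W ^ 0 = 1`.
  ((1, 0, 0), (E.balancedExps x).map fun e => (0, (0, 0), e), [], x, [])

/-- The family of solutions obtained by solving for a variable that is linear in the term `j`. -/
def linearSpec (j : Fin 3) (x : List ℤ) (z : List ℕ) (r : List ℕ) : Spec :=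
  ((E.termAt j x, -E.termAt (j + 1) x, -E.termAt (j + 2) x),
    ((List.range (E.freeExps j).length).map fun k : ℕ =>
      ((r.getD k 0 : ℤ),
        -- The natural subtractions here and in the restricted part are exact, because the
        -- subtracted weight is the least one on `freeExps` and on `divExps`.
        (E.listWeight (j + 1) ((E.freeExps j).getD k []) - E.listWeight j ((E.freeExps j).getD k []),
         E.listWeight (j + 2) ((E.freeExps j).getD k []) - E.listWeight j ((E.freeExps j).getD k [])),
        (E.freeExps j).getD k [])),
    (E.divExps j).map fun e => (E.listWeight j e - E.listWeight (j + 1) e, e), x, z)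

def scalingSpecs : List Spec :=
  (E.basePoints.filter fun x => E.termAt 0 x + E.termAt 1 x + E.termAt 2 x = 0).map E.scalingSpec

def linearSpecs : List Spec :=
  [0, 1, 2].flatMap fun j => E.basePoints.flatMap fun x => (E.linearExps j).flatMap fun z =>
    (words (List.range (E.termAt j x).natAbs) (E.freeExps j).length).map fun r =>
      E.linearSpec j x z r

instance (S : Spec) : Decidable S.Valid := by unfold Spec.Valid; infer_instance

/-- The filter removes the data with `A = 0` or with residues for which the numerator is not
divisible by `A`. -/
def solve : List Family :=
  ((E.scalingSpecs ++ E.linearSpecs).filter fun S => S.Valid).map Spec.family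

variable {E}

theorem expAt_eq (j : Fin 3) (i : Fin E.nvars) : E.expAt j i = E.exponent j i := by
  simp [expAt, exponent]

theorem listWeight_eq (j : Fin 3) (e : List ℕ) :
    E.listWeight j e = E.weight j fun i => e.getD i 0 := by
  rw [listWeight, weight, Finset.sum_range]
  exact Finset.sum_congr rfl fun i _ => by rw [expAt_eq]

theorem termAt_eq (j : Fin 3) (x : List ℤ) :
    E.termAt j x = E.coeff j * ∏ i : Fin E.nvars, x.getD i 0 ^ E.exponent j i := by
  rw [termAt, Finset.prod_range]
  congr 1
  exact Finset.prod_congr rfl fun i _ => by rw [expAt_eq]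

theorem getD_ofFn {α : Type*} {n : ℕ} (f : Fin n → α) (d : α) (i : Fin n) :
    (List.ofFn f).getD i d = f i := by
  rw [List.getD_eq_getElem _ _ (by simp)]
  simp

theorem listWeight_ofFn (j : Fin 3) (e : Fin E.nvars → ℕ) :
    E.listWeight j (List.ofFn e) = E.weight j e := by
  rw [listWeight_eq]
  congr 1
  funext i
  exact getD_ofFn _ _ _

theorem ofFn_mem_box {e : Fin E.nvars → ℕ} : List.ofFn e ∈ E.box ↔ ∀ i, e i ≤ E.expBound := by
  simp [box, mem_words, List.mem_ofFn']

theorem ofFn_mem_basePoints {x : Fin E.nvars → ℤ} (h : ∀ i, |x i| ≤ E.baseBound) :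
    List.ofFn x ∈ E.basePoints := by
  simp only [basePoints, mem_words, List.length_ofFn, true_and, List.mem_ofFn', Set.forall_mem_range,
    List.mem_map, List.mem_range]
  intro i
  have := abs_le.mp (h i)
  exact ⟨(x i + E.baseBound).toNat, by omega, by omega⟩

theorem weight_add (j : Fin 3) (y z : Fin E.nvars → ℕ) :
    E.weight j (y + z) = E.weight j y + E.weight j z := by
  simp [weight, mul_add, Finset.sum_add_distrib]

theorem exponent_lt_size (j : Fin 3) (i : Fin E.nvars) : E.exponent j i < E.size := by
  have h := Finset.single_le_sum (f := fun i => E.expAt 0 i + E.expAt 1 i + E.expAt 2 i)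
    (s := Finset.range E.2.length) (fun _ _ => Nat.zero_le _) (Finset.mem_range.mpr i.2)
  have h2 : E.exponent j i ≤ E.expAt 0 i + E.expAt 1 i + E.expAt 2 i := by
    rw [← expAt_eq]
    fin_cases j <;> simp <;> omega
  have := h2.trans h
  unfold size
  omega

theorem coeffVal_lt_size (ha : ∀ j, E.coeff j ≠ 0) {p : ℕ} (hp : p.Prime) (j : Fin 3) :
    E.coeffVal p j < E.size := by
  have h0 : (E.coeff j).natAbs ≠ 0 := Int.natAbs_ne_zero.mpr (ha j)
  have h1 : E.coeffVal p j < (E.coeff j).natAbs := by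
    have := Nat.factorization_lt p h0
    rwa [Nat.factorization_def _ hp] at this
  have h2 : (E.coeff j).natAbs ≤ (E.coeff 0).natAbs + (E.coeff 1).natAbs + (E.coeff 2).natAbs := by
    fin_cases j <;> simp <;> omega
  unfold size
  omega

theorem weight_sub_weight (i j : Fin 3) (z : Fin E.nvars → ℕ) :
    ∑ l, ((E.exponent i l : ℤ) - E.exponent j l) * z l = (E.weight i z : ℤ) - E.weight j z := by
  simp [weight, sub_mul, Finset.sum_sub_distrib]

/-- The system bound for prime exponents: `c` stands for the exponents of a prime in the
coefficients, the terms `i` and `j` tie, and the term `k` is no smaller. For `c = 0` the system is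
homogeneous. -/
theorem exists_bounded_add_closure_weight (i j k : Fin 3) (c : Fin 3 → ℕ) (hc : ∀ l, c l ≤ E.size)
    (z : Fin E.nvars → ℕ) (h1 : c i + E.weight i z = c j + E.weight j z)
    (h2 : c i + E.weight i z ≤ c k + E.weight k z) :
    ∃ z₀ y : Fin E.nvars → ℕ, z = z₀ + y ∧ (∀ l, z₀ l ≤ E.expBound) ∧ (c = 0 → z₀ = 0) ∧
      y ∈ AddSubmonoid.closure {e : Fin E.nvars → ℕ | (∀ l, e l ≤ E.expBound) ∧
        E.weight i e = E.weight j e ∧ E.weight i e ≤ E.weight k e} := by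
  have hw : ∀ (j k : Fin 3) l, |(E.exponent j l : ℤ) - E.exponent k l| ≤ E.size := by
    intro j k l
    have h1 := exponent_lt_size j l
    have h2 := exponent_lt_size k l
    rw [abs_le]; omega
  have hc' : ∀ j k : Fin 3, |(c j : ℤ) - c k| ≤ E.size := by
    intro j k
    have h1 := hc j
    have h2 := hc k
    rw [abs_le]; omega
  obtain ⟨z₀, y, h3, h4, h5, h6⟩ := exists_bounded_add_closure_system
    (fun l => (E.exponent i l : ℤ) - E.exponent j l) (fun l => (E.exponent k l : ℤ) - E.exponent i l)
    ((c i : ℤ) - c j) ((c k : ℤ) - c i) E.size (hw i j) (hw k i) (hc' i j) (hc' k i) z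
    (by rw [weight_sub_weight]; omega) (by rw [weight_sub_weight]; omega)
  refine ⟨z₀, y, h3, h4, fun h => h5 (by simp [h]) (by simp [h]), ?_⟩
  refine AddSubmonoid.closure_mono ?_ h6
  rintro e ⟨he, he1, he2⟩
  rw [weight_sub_weight] at he1 he2
  exact ⟨he, by omega, by omega⟩

/-- Every point that is suitable at all primes is obtained from one of finitely many points by
scaling with the exponent vectors from `l`. -/
theorem exists_basePoint (ha : ∀ j, E.coeff j ≠ 0) (x : Fin E.nvars → ℤ) (l : List (List ℕ))
    (h : ∀ p : ℕ, p.Prime → ∃ i j k : Fin 3,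
      E.coeffVal p i + E.weight i (fun l => padicValInt p (x l)) =
        E.coeffVal p j + E.weight j (fun l => padicValInt p (x l)) ∧
      E.coeffVal p i + E.weight i (fun l => padicValInt p (x l)) ≤
        E.coeffVal p k + E.weight k (fun l => padicValInt p (x l)) ∧
      ∀ e ∈ E.box, E.listWeight i e = E.listWeight j e → E.listWeight i e ≤ E.listWeight k e → e ∈ l) :
    ∃ x₀ ∈ E.basePoints, ∃ U : ℕ → ℤ, (∀ k, U k ≠ 0) ∧ (∀ i : Fin E.nvars, x₀.getD i 0 = 0 ↔ x i = 0) ∧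
      ∀ i : Fin E.nvars, x i = x₀.getD i 0 * ∏ k ∈ Finset.range l.length, U k ^ (l.getD k []).getD i 0 := by
  have hN : (E.coeff 0).natAbs * (E.coeff 1).natAbs * (E.coeff 2).natAbs ≠ 0 := by
    have h0 := ha 0
    have h1 := ha 1
    have h2 := ha 2
    simp [h0, h1, h2]
  obtain ⟨x₀, U, hU, hx₀, hB, hx⟩ := exists_eq_mul_prod_pow
    (fun (k : Fin l.length) (i : Fin E.nvars) => l[k].getD i 0) hN E.expBound x (by
      intro p hp
      obtain ⟨i, j, k, h1, h2, h3⟩ := h p hp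
      -- Which terms tie depends on `p`; the generators for all occurring ties are collected in the
      -- one list `l`.
      obtain ⟨z₀, y, h4, h5, h6, h7⟩ := exists_bounded_add_closure_weight i j k (E.coeffVal p)
        (fun j => (coeffVal_lt_size ha hp j).le) _ h1 h2
      have hy : y ∈ AddSubmonoid.closure
          (Set.range fun (k : Fin l.length) (i : Fin E.nvars) => l[k].getD i 0) := by
        refine AddSubmonoid.closure_mono ?_ h7
        rintro e ⟨he, he1, he2⟩
        have := h3 (List.ofFn e) (ofFn_mem_box.mpr he) (by simpa only [listWeight_ofFn] using he1)
          (by simpa only [listWeight_ofFn] using he2)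
        obtain ⟨k, hk, hke⟩ := List.mem_iff_getElem.mp this
        refine ⟨⟨k, hk⟩, funext fun i => ?_⟩
        simp only [Fin.getElem_fin, hke]
        exact getD_ofFn _ _ _
      rw [AddSubmonoid.mem_closure_range_iff_of_fintype] at hy
      obtain ⟨m, rfl⟩ := hy
      refine ⟨z₀, m, h5, fun hpa => h6 (funext fun j => ?_), fun i => ?_⟩
      · refine padicValNat.eq_zero_of_not_dvd fun hd => hpa (hd.trans ?_)
        fin_cases j
        · exact (dvd_mul_right _ _).mul_right _
        · exact (dvd_mul_left _ _).mul_right _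
        · exact dvd_mul_left _ _
      · have := congrFun h4 i
        simpa using this)
  -- Outside the list `U` takes the value 1, to remain non-zero everywhere.
  refine ⟨List.ofFn x₀, ofFn_mem_basePoints (fun i => ?_), fun k => if hk : k < l.length then U ⟨k, hk⟩ else 1,
    fun k => ?_, fun i => ?_, fun i => ?_⟩
  · simpa [baseBound] using hB i
  · dsimp only; split_ifs <;> simp [hU]
  · rw [getD_ofFn]; exact hx₀ i
  · rw [getD_ofFn, Finset.prod_range, hx i]
    congr 1
    refine Finset.prod_congr rfl fun k _ => ?_
    rw [List.getD_eq_getElem l [] k.2]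
    simp

/-- The value of a term at a point of a family. -/
theorem coeff_mul_prod_coord (j : Fin 3) (S : Spec) (v : ℕ → ℤ) (W : ℤ) :
    E.coeff j * ∏ i : Fin E.nvars, S.coord v W i ^ E.exponent j i =
      E.termAt j S.2.2.2.1 *
        (∏ k ∈ Finset.range S.numFree, S.free v k ^ E.listWeight j (S.freeData k).2.2) *
        ((∏ k ∈ Finset.range S.numDiv, v (S.numFree + k) ^ E.listWeight j (S.divData k).2) *
          W ^ E.listWeight j S.2.2.2.2) := by
  have key : ∀ (K : ℕ) (f : ℕ → ℤ) (e : ℕ → List ℕ),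
      ∏ i : Fin E.nvars, (∏ k ∈ Finset.range K, f k ^ (e k).getD i 0) ^ E.exponent j i =
        ∏ k ∈ Finset.range K, f k ^ E.listWeight j (e k) := by
    intro K f e
    simp only [← Finset.prod_pow]
    rw [Finset.prod_comm]
    refine Finset.prod_congr rfl fun k _ => ?_
    simp only [← pow_mul]
    rw [Finset.prod_pow_eq_pow_sum, listWeight_eq, weight]
    congr 1
    exact Finset.sum_congr rfl fun i _ => mul_comm _ _
  have key2 : ∏ i : Fin E.nvars, (W ^ S.baseExp i) ^ E.exponent j i = W ^ E.listWeight j S.2.2.2.2 := by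
    simp only [← pow_mul]
    rw [Finset.prod_pow_eq_pow_sum, listWeight_eq, weight]
    congr 1
    exact Finset.sum_congr rfl fun i _ => mul_comm _ _
  rw [termAt_eq, ← key, ← key, ← key2]
  simp only [Spec.coord, Spec.base, mul_pow, Finset.prod_mul_distrib]
  ring

theorem isSolution_iff (j : Fin 3) (x : Fin E.nvars → ℤ) : E.IsSolution x ↔
    E.coeff j * ∏ i, x i ^ E.exponent j i + E.coeff (j + 1) * ∏ i, x i ^ E.exponent (j + 1) i +
      E.coeff (j + 2) * ∏ i, x i ^ E.exponent (j + 2) i = 0 := by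
  rw [IsSolution, Fin.sum_univ_three]
  fin_cases j
  · exact Iff.rfl
  · simp only [Fin.reduceFinMk, Fin.isValue, Fin.reduceAdd]
    constructor <;> intro h <;> linarith
  · simp only [Fin.reduceFinMk, Fin.isValue, Fin.reduceAdd]
    constructor <;> intro h <;> linarith

theorem padicValInt_term {p : ℕ} (hp : p.Prime) (j : Fin 3) (x : Fin E.nvars → ℤ)
    (h : E.coeff j * ∏ i, x i ^ E.exponent j i ≠ 0) :
    padicValInt p (E.coeff j * ∏ i, x i ^ E.exponent j i) =
      E.coeffVal p j + E.weight j fun l => padicValInt p (x l) :=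
  haveI := Fact.mk hp
  padicValInt_prod_pow p _ _ _ h

theorem basePoints_length {x : List ℤ} (hx : x ∈ E.basePoints) : x.length = E.nvars :=
  (mem_words.mp hx).1

theorem scalingSpec_valid (x : List ℤ) : (E.scalingSpec x).Valid := by
  simp [Spec.Valid, scalingSpec, Spec.lead]

theorem getD_mem {α : Type*} {l : List α} {k : ℕ} (hk : k < l.length) (d : α) : l.getD k d ∈ l := by
  rw [List.getD_eq_getElem _ _ hk]; exact List.getElem_mem hk

theorem scalingSpec_freeData (x : List ℤ) {k : ℕ} (hk : k < (E.scalingSpec x).numFree) :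
    (E.scalingSpec x).freeData k = (0, (0, 0), (E.balancedExps x).getD k []) := by
  have : k < (E.balancedExps x).length := by simpa [Spec.numFree, scalingSpec] using hk
  simp [Spec.freeData, scalingSpec, this]

/-- The left-hand side of the equation on a family obtained by scaling. -/
theorem exists_sum_scalingSpec (x : List ℤ) (v : ℕ → ℤ) (W : ℤ) {y : Fin E.nvars → ℤ}
    (hy : ∀ i, y i = (E.scalingSpec x).coord v W i) :
    ∃ P : ℤ, ((∀ k < (E.scalingSpec x).numFree, v k ≠ 0) → P ≠ 0) ∧
      ∑ j, E.coeff j * ∏ i, y i ^ E.exponent j i =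
        (E.termAt 0 x + E.termAt 1 x + E.termAt 2 x) * P := by
  obtain rfl := funext hy
  rw [Fin.sum_univ_three]
  simp only [coeff_mul_prod_coord]
  set S := E.scalingSpec x with hS
  have h0 : S.numDiv = 0 := rfl
  have hz : ∀ j, E.listWeight j S.2.2.2.2 = 0 := fun j => by
    simp [hS, scalingSpec, listWeight]
  simp only [h0, Finset.range_zero, Finset.prod_empty, hz, pow_zero, mul_one]
  set P : Fin 3 → ℤ := fun j => ∏ k ∈ Finset.range S.numFree, S.free v k ^ E.listWeight j (S.freeData k).2.2
    with hP
  have hbal : ∀ k < S.numFree, _ := fun k hk => (List.mem_filter.mp (getD_mem (l := E.balancedExps x)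
    (by simpa [hS, Spec.numFree, scalingSpec] using hk) [])).2
  simp only [decide_eq_true_eq] at hbal
  have hPP : ∀ i j : Fin 3, (∀ k < S.numFree, E.listWeight i ((E.balancedExps x).getD k []) =
      E.listWeight j ((E.balancedExps x).getD k [])) → P i = P j := by
    intro i j h
    refine Finset.prod_congr rfl fun k hk => ?_
    rw [Finset.mem_range] at hk
    rw [scalingSpec_freeData x hk]
    simp only [h k hk]
  have hne : ∀ j, (∀ k < S.numFree, v k ≠ 0) → P j ≠ 0 := by
    intro j h
    refine Finset.prod_ne_zero_iff.mpr fun k hk => pow_ne_zero _ ?_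
    rw [Finset.mem_range] at hk
    rw [Spec.free, scalingSpec_freeData x hk]
    simpa [hS, Spec.lead, scalingSpec] using h k hk
  change ∃ R, _ ∧ E.termAt 0 x * P 0 + E.termAt 1 x * P 1 + E.termAt 2 x * P 2 = _
  -- The common factor is that of any term not vanishing at `x`; balance makes it the same for all
  -- such terms.
  by_cases h0 : E.termAt 0 x = 0
  · by_cases h1 : E.termAt 1 x = 0
    · exact ⟨P 2, hne 2, by rw [h0, h1]; ring⟩
    · refine ⟨P 1, hne 1, ?_⟩
      by_cases h2 : E.termAt 2 x = 0
      · rw [h0, h2]; ring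
      · rw [h0, hPP 2 1 fun k hk => (((hbal k hk).2.1.resolve_left h1).resolve_left h2).symm]; ring
  · refine ⟨P 0, hne 0, ?_⟩
    have e1 : E.termAt 1 x * P 1 = E.termAt 1 x * P 0 := by
      by_cases h1 : E.termAt 1 x = 0
      · simp [h1]
      · rw [hPP 1 0 fun k hk => (((hbal k hk).1.resolve_left h0).resolve_left h1).symm]
    have e2 : E.termAt 2 x * P 2 = E.termAt 2 x * P 0 := by
      by_cases h2 : E.termAt 2 x = 0
      · simp [h2]
      · rw [hPP 2 0 fun k hk => (((hbal k hk).2.2.resolve_left h0).resolve_left h2).symm]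
    rw [e1, e2]; ring

/-- Only the zero pattern of the coordinates matters, so a solution and its base point have the same
vanishing terms and hence the same balanced vectors. -/
theorem term_eq_zero_iff {x y : Fin E.nvars → ℤ} (h : ∀ i, x i = 0 ↔ y i = 0) (j : Fin 3) :
    E.coeff j * ∏ i, x i ^ E.exponent j i = 0 ↔ E.coeff j * ∏ i, y i ^ E.exponent j i = 0 := by
  simp only [mul_eq_zero, Finset.prod_eq_zero_iff, Finset.mem_univ, true_and, pow_eq_zero_iff', h]

theorem balancedExps_congr {x y : List ℤ} (h : ∀ j, E.termAt j x = 0 ↔ E.termAt j y = 0) :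
    E.balancedExps x = E.balancedExps y := by
  simp only [balancedExps, h]

theorem eq_or_eq_add_one_or_eq_add_two : ∀ j l : Fin 3, l = j ∨ l = j + 1 ∨ l = j + 2 := by decide

/-- A solution for which a term vanishes is found by scaling. -/
theorem exists_scalingSpec (ha : ∀ j, E.coeff j ≠ 0) {x : Fin E.nvars → ℤ} (hx : E.IsSolution x)
    {j : Fin 3} (hj : E.coeff j * ∏ i, x i ^ E.exponent j i = 0) :
    ∃ S ∈ E.scalingSpecs, x ∈ S.family.points E.nvars := by
  have hterm : ∀ j, E.termAt j (List.ofFn x) = E.coeff j * ∏ i, x i ^ E.exponent j i := by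
    intro j
    simp only [termAt_eq, getD_ofFn]
  obtain ⟨x₀, hx₀, U, hU, hzero, hxU⟩ := exists_basePoint ha x (E.balancedExps (List.ofFn x)) (by
    intro p hp
    have hs := (isSolution_iff j x).mp hx
    rw [hj, zero_add] at hs
    by_cases h1 : E.coeff (j + 1) * ∏ i, x i ^ E.exponent (j + 1) i = 0
    · have h2 : E.coeff (j + 2) * ∏ i, x i ^ E.exponent (j + 2) i = 0 := by simpa [h1] using hs
      have hall : ∀ l, E.termAt l (List.ofFn x) = 0 := by
        intro l
        rw [hterm]
        obtain rfl | rfl | rfl := eq_or_eq_add_one_or_eq_add_two j l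
        exacts [hj, h1, h2]
      exact ⟨0, 0, 0, rfl, le_rfl, fun e he _ _ => by simp [balancedExps, he, hall]⟩
    · have h2 : E.coeff (j + 2) * ∏ i, x i ^ E.exponent (j + 2) i =
          -(E.coeff (j + 1) * ∏ i, x i ^ E.exponent (j + 1) i) := by linarith
      have h3 : E.coeff (j + 2) * ∏ i, x i ^ E.exponent (j + 2) i ≠ 0 := by
        rw [h2]; exact neg_ne_zero.mpr h1
      -- The two surviving terms are opposite, so their exponents agree at every prime. No
      -- inequality is needed; the third index repeats the first.
      refine ⟨j + 1, j + 2, j + 1, ?_, le_rfl, fun e he h _ => ?_⟩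
      · rw [← padicValInt_term hp _ _ h1, ← padicValInt_term hp _ _ h3, h2, padicValInt, padicValInt,
          Int.natAbs_neg]
      · rw [← hterm] at hj
        simp only [balancedExps, List.mem_filter, he, true_and, decide_eq_true_eq]
        fin_cases j
        · have h : E.listWeight 1 e = E.listWeight 2 e := h
          exact ⟨Or.inl hj, Or.inr (Or.inr h), Or.inl hj⟩
        · have h : E.listWeight 2 e = E.listWeight 0 e := h
          exact ⟨Or.inr (Or.inl hj), Or.inl hj, Or.inr (Or.inr h.symm)⟩
        · have h : E.listWeight 0 e = E.listWeight 1 e := h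
          exact ⟨Or.inr (Or.inr h), Or.inr (Or.inl hj), Or.inr (Or.inl hj)⟩)
  have hbal : E.balancedExps (List.ofFn x) = E.balancedExps x₀ := by
    refine balancedExps_congr fun j => ?_
    rw [hterm, termAt_eq]
    exact (term_eq_zero_iff (fun i => hzero i) j).symm
  rw [hbal] at hxU
  have hfree : ∀ k < (E.scalingSpec x₀).numFree, (E.scalingSpec x₀).free U k = U k := by
    intro k hk
    rw [Spec.free, scalingSpec_freeData x₀ hk]
    simp [Spec.lead, scalingSpec]
  have hcoord : ∀ i : Fin E.nvars, x i = (E.scalingSpec x₀).coord U 0 i := by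
    intro i
    rw [hxU i, Spec.coord]
    have h1 : (E.scalingSpec x₀).numDiv = 0 := rfl
    have h2 : (E.scalingSpec x₀).baseExp i = 0 := by simp [Spec.baseExp, scalingSpec]
    have h3 : (E.scalingSpec x₀).numFree = (E.balancedExps x₀).length := by
      simp [Spec.numFree, scalingSpec]
    rw [h1, h2, Finset.range_zero, Finset.prod_empty, pow_zero, mul_one, mul_one]
    congr 1
    refine Finset.prod_congr (by rw [h3]) fun k hk => ?_
    rw [Finset.mem_range] at hk
    rw [hfree k hk, scalingSpec_freeData x₀ hk]
  refine ⟨E.scalingSpec x₀, List.mem_map.mpr ⟨x₀, List.mem_filter.mpr ⟨hx₀, ?_⟩, rfl⟩, ?_⟩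
  · obtain ⟨P, hP, h⟩ := exists_sum_scalingSpec x₀ U 0 hcoord
    rw [hx] at h
    simpa [hP fun k _ => hU k] using h.symm
  · refine (Spec.mem_family_points (scalingSpec_valid x₀) (basePoints_length hx₀).symm x).mpr
      ⟨U, 0, fun l hl => absurd hl (Nat.not_lt_zero l), ?_, hcoord⟩
    simp [Spec.num, scalingSpec]

theorem isSolution_of_mem_scalingSpecs {S : Spec} (hS : S ∈ E.scalingSpecs) {x : Fin E.nvars → ℤ}
    (hx : x ∈ S.family.points E.nvars) : E.IsSolution x := by
  obtain ⟨x₀, hx₀, rfl⟩ := List.mem_map.mp hS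
  obtain ⟨hx₀, h0⟩ := List.mem_filter.mp hx₀
  simp only [decide_eq_true_eq] at h0
  obtain ⟨v, W, -, -, h⟩ := (Spec.mem_family_points (scalingSpec_valid x₀)
    (basePoints_length hx₀).symm x).mp hx
  obtain ⟨P, -, hP⟩ := exists_sum_scalingSpec x₀ v W h
  rw [IsSolution, hP, h0, zero_mul]

end Equation
end ThreeMon

/-! ### The solutions for which no term vanishes, and correctness of the algorithm. -/

namespace ThreeMon
namespace Equation
variable {E : Equation}

section
variable (E) (j : Fin 3) (x : List ℤ) (z r : List ℕ)

theorem linearSpec_numFree : (E.linearSpec j x z r).numFree = (E.freeExps j).length := by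
  simp [Spec.numFree, linearSpec]

theorem linearSpec_numDiv : (E.linearSpec j x z r).numDiv = (E.divExps j).length := by
  simp [Spec.numDiv, linearSpec]

variable {k : ℕ}

theorem linearSpec_freeData (hk : k < (E.freeExps j).length) :
    (E.linearSpec j x z r).freeData k = ((r.getD k 0 : ℤ),
        (E.listWeight (j + 1) ((E.freeExps j).getD k []) - E.listWeight j ((E.freeExps j).getD k []),
         E.listWeight (j + 2) ((E.freeExps j).getD k []) - E.listWeight j ((E.freeExps j).getD k [])),
        (E.freeExps j).getD k []) := by
  simp [Spec.freeData, linearSpec, hk]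

theorem linearSpec_divData (hk : k < (E.divExps j).length) :
    (E.linearSpec j x z r).divData k =
      (E.listWeight j ((E.divExps j).getD k []) - E.listWeight (j + 1) ((E.divExps j).getD k []),
        (E.divExps j).getD k []) := by
  simp [Spec.divData, linearSpec, hk]

end

theorem weight_of_mem_freeExps {j : Fin 3} {e : List ℕ} (he : e ∈ E.freeExps j) :
    E.listWeight j e ≤ E.listWeight (j + 1) e ∧ E.listWeight j e ≤ E.listWeight (j + 2) e := by
  have := (List.mem_filter.mp he).2
  simp only [decide_eq_true_eq] at this
  omega

theorem weight_of_mem_divExps {j : Fin 3} {e : List ℕ} (he : e ∈ E.divExps j) :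
    E.listWeight (j + 1) e = E.listWeight (j + 2) e ∧ E.listWeight (j + 1) e ≤ E.listWeight j e := by
  simpa using (List.mem_filter.mp he).2

/-- The left-hand side of the equation on a family obtained by solving for a linear variable. -/
theorem exists_sum_linearSpec (j : Fin 3) (x : List ℤ) {z : List ℕ} (hz : z ∈ E.linearExps j)
    (r : List ℕ) (v : ℕ → ℤ) (W : ℤ) {y : Fin E.nvars → ℤ}
    (hy : ∀ i, y i = (E.linearSpec j x z r).coord v W i) :
    ∃ G : ℤ, ((∀ k < (E.freeExps j).length, (E.linearSpec j x z r).free v k ≠ 0) →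
        (∀ k < (E.divExps j).length, v ((E.freeExps j).length + k) ≠ 0) → W ≠ 0 → G ≠ 0) ∧
      E.coeff j * ∏ i, y i ^ E.exponent j i + E.coeff (j + 1) * ∏ i, y i ^ E.exponent (j + 1) i +
        E.coeff (j + 2) * ∏ i, y i ^ E.exponent (j + 2) i =
      G * ((E.linearSpec j x z r).den v (E.linearSpec j x z r).numDiv * W -
        (E.linearSpec j x z r).num v) := by
  obtain rfl := funext hy
  simp only [coeff_mul_prod_coord]
  obtain ⟨hz1, hz2⟩ : E.listWeight (j + 1) z = E.listWeight (j + 2) z ∧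
      E.listWeight j z = E.listWeight (j + 1) z + 1 := by simpa using (List.mem_filter.mp hz).2
  set S := E.linearSpec j x z r with hS
  have hF : S.numFree = (E.freeExps j).length := linearSpec_numFree E j x z r
  have hD : S.numDiv = (E.divExps j).length := linearSpec_numDiv E j x z r
  have hzS : S.2.2.2.2 = z := rfl
  have hxS : S.2.2.2.1 = x := rfl
  have f1 : ∀ k ∈ Finset.range S.numFree,
      S.free v k ^ E.listWeight (j + 1) (S.freeData k).2.2 =
        S.free v k ^ (S.freeData k).2.1.1 * S.free v k ^ E.listWeight j (S.freeData k).2.2 := by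
    intro k hk
    rw [Finset.mem_range, hF] at hk
    rw [← pow_add, linearSpec_freeData E j x z r hk]
    have := weight_of_mem_freeExps (getD_mem hk [])
    congr 1
    simp only
    omega
  have f2 : ∀ k ∈ Finset.range S.numFree,
      S.free v k ^ E.listWeight (j + 2) (S.freeData k).2.2 =
        S.free v k ^ (S.freeData k).2.1.2 * S.free v k ^ E.listWeight j (S.freeData k).2.2 := by
    intro k hk
    rw [Finset.mem_range, hF] at hk
    rw [← pow_add, linearSpec_freeData E j x z r hk]
    have := weight_of_mem_freeExps (getD_mem hk [])
    congr 1
    simp only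
    omega
  have d0 : ∀ k ∈ Finset.range S.numDiv,
      v (S.numFree + k) ^ E.listWeight j (S.divData k).2 =
        v (S.numFree + k) ^ (S.divData k).1 * v (S.numFree + k) ^ E.listWeight (j + 1) (S.divData k).2 := by
    intro k hk
    rw [Finset.mem_range, hD] at hk
    rw [← pow_add, linearSpec_divData E j x z r hk]
    have := weight_of_mem_divExps (getD_mem hk [])
    congr 1
    simp only
    omega
  have d2 : ∀ k ∈ Finset.range S.numDiv,
      v (S.numFree + k) ^ E.listWeight (j + 2) (S.divData k).2 =
        v (S.numFree + k) ^ E.listWeight (j + 1) (S.divData k).2 := by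
    intro k hk
    rw [Finset.mem_range, hD] at hk
    rw [linearSpec_divData E j x z r hk]
    have := weight_of_mem_divExps (getD_mem hk [])
    congr 1
    simp only
    omega
  -- This is the common factor of the three terms: the weight in `j` is the least for free
  -- parameters, the weight in `j + 1` for restricted ones and for `W`. After cancelling it, `W`
  -- occurs to the first power, and only in the term `j`.
  refine ⟨(∏ k ∈ Finset.range S.numFree, S.free v k ^ E.listWeight j (S.freeData k).2.2) *
    (∏ k ∈ Finset.range S.numDiv, v (S.numFree + k) ^ E.listWeight (j + 1) (S.divData k).2) *
    W ^ E.listWeight (j + 1) z, fun h1 h2 h3 => ?_, ?_⟩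
  · refine mul_ne_zero (mul_ne_zero ?_ ?_) (pow_ne_zero _ h3)
    · exact Finset.prod_ne_zero_iff.mpr fun k hk => pow_ne_zero _ (h1 k (by simpa [hF] using hk))
    · rw [hF]
      exact Finset.prod_ne_zero_iff.mpr fun k hk => pow_ne_zero _ (h2 k (by simpa [hD] using hk))
  · rw [Finset.prod_congr rfl f1, Finset.prod_congr rfl f2, Finset.prod_congr rfl d0,
      Finset.prod_congr rfl d2, hzS, hxS, hz2, ← hz1]
    simp only [Finset.prod_mul_distrib, Spec.den, Spec.num]
    have hl : S.lead = E.termAt j x := rfl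
    have hB : S.1.2.1 = -E.termAt (j + 1) x := rfl
    have hC : S.1.2.2 = -E.termAt (j + 2) x := rfl
    rw [hl, hB, hC]
    ring

theorem isSolution_of_mem_linearSpecs {S : Spec} (hS : S ∈ E.linearSpecs) (hv : S.Valid)
    {x : Fin E.nvars → ℤ} (hx : x ∈ S.family.points E.nvars) : E.IsSolution x := by
  simp only [linearSpecs, List.mem_flatMap, List.mem_map] at hS
  obtain ⟨j, -, x₀, hx₀, z, hz, r, -, rfl⟩ := hS
  obtain ⟨v, W, -, hW, h⟩ := (Spec.mem_family_points hv (basePoints_length hx₀).symm x).mp hx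
  obtain ⟨G, -, hG⟩ := exists_sum_linearSpec j x₀ hz r v W h
  rw [isSolution_iff j, hG, hW, sub_self, mul_zero]

/-- Under the condition some term can be made linear. -/
theorem exists_linearExps (hE : E.Condition) : ∃ j, E.linearExps j ≠ [] := by
  obtain ⟨i, i', j, h1, h2, h3, z, hz1, hz2⟩ := hE
  refine ⟨j, ?_⟩
  have hi : (i = j + 1 ∧ i' = j + 2) ∨ (i = j + 2 ∧ i' = j + 1) := by
    clear hz1 hz2
    revert i i' j; decide
  have hz : E.weight (j + 1) z = E.weight (j + 2) z ∧ E.weight j z = E.weight (j + 1) z + 1 := by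
    rcases hi with ⟨rfl, rfl⟩ | ⟨rfl, rfl⟩ <;> omega
  obtain ⟨z₀, y, rfl, -, h0, hy⟩ := exists_bounded_add_closure_weight (j + 1) (j + 2) j 0
    (fun _ => Nat.zero_le _) z (by simpa using hz.1) (by simp; omega)
  rw [h0 rfl, zero_add] at hz
  -- The excess of the weight in `j` over that in `j + 1` is additive and non-negative on the
  -- bounded generators. If it is 1 on their sum, it is 1 on one of them, so a search in the box
  -- finds a witness of the condition.
  have key : ∀ y ∈ AddSubmonoid.closure {e : Fin E.nvars → ℕ | (∀ l, e l ≤ E.expBound) ∧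
      E.weight (j + 1) e = E.weight (j + 2) e ∧ E.weight (j + 1) e ≤ E.weight j e},
      E.weight (j + 1) y ≤ E.weight j y ∧ (E.weight j y = E.weight (j + 1) y + 1 →
        ∃ e : Fin E.nvars → ℕ, (∀ l, e l ≤ E.expBound) ∧ E.weight (j + 1) e = E.weight (j + 2) e ∧
          E.weight j e = E.weight (j + 1) e + 1) := by
    intro y hy
    induction hy using AddSubmonoid.closure_induction with
    | mem e he => exact ⟨he.2.2, fun h => ⟨e, he.1, he.2.1, h⟩⟩
    | zero => simp [weight]
    | add a b _ _ iha ihb =>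
      simp only [weight_add]
      refine ⟨by omega, fun h => ?_⟩
      by_cases h' : E.weight j a = E.weight (j + 1) a + 1
      · exact iha.2 h'
      · exact ihb.2 (by omega)
  obtain ⟨e, he, he1, he2⟩ := (key y hy).2 hz.2
  refine List.ne_nil_of_mem (a := List.ofFn e) (List.mem_filter.mpr ⟨ofFn_mem_box.mpr he, ?_⟩)
  simp [listWeight_ofFn, he1, he2]

/-- A solution for which no term vanishes is found by solving for a linear variable. -/
theorem exists_linearSpec (ha : ∀ j, E.coeff j ≠ 0) (hE : E.Condition) {x : Fin E.nvars → ℤ}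
    (hx : E.IsSolution x) (hne : ∀ j, E.coeff j * ∏ i, x i ^ E.exponent j i ≠ 0) :
    ∃ S ∈ E.linearSpecs, S.Valid ∧ x ∈ S.family.points E.nvars := by
  obtain ⟨j, hj⟩ := exists_linearExps hE
  obtain ⟨z, hz⟩ := List.exists_mem_of_ne_nil _ hj
  obtain ⟨x₀, hx₀, U, hU, hzero, hxU⟩ := exists_basePoint ha x (E.freeExps j ++ E.divExps j) (by
    intro p hp
    have hs := (isSolution_iff j x).mp hx
    have := Fact.mk hp
    -- A tie that involves the term `j` leads to free parameters, a tie of the two other terms to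
    -- restricted ones.
    have h := padicValInt_eq_of_add_eq_zero p (hne j) (hne (j + 1)) (hne (j + 2)) hs
    simp only [padicValInt_term hp _ x (hne _)] at h
    rcases h with h | h | h
    · exact ⟨j, j + 1, j + 2, h.1, h.2, fun e he h1 h2 => List.mem_append_left _
        (List.mem_filter.mpr ⟨he, by simpa using Or.inl ⟨h1, h2⟩⟩)⟩
    · exact ⟨j + 1, j + 2, j, h.1, h.2, fun e he h1 h2 => List.mem_append_right _
        (List.mem_filter.mpr ⟨he, by simpa using ⟨h1, h2⟩⟩)⟩
    · exact ⟨j, j + 2, j + 1, h.1, h.2, fun e he h1 h2 => List.mem_append_left _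
        (List.mem_filter.mpr ⟨he, by simpa using Or.inr ⟨h1, h2⟩⟩)⟩)
  have hA : E.termAt j x₀ ≠ 0 := by
    rw [termAt_eq]
    exact fun h => hne j ((term_eq_zero_iff (fun i => hzero i) j).mp h)
  set A := E.termAt j x₀ with hAdef
  set K := (E.freeExps j).length with hK
  set r : List ℕ := (List.range K).map fun k : ℕ => (U k % A).toNat with hr
  set S := E.linearSpec j x₀ z r with hS
  -- Free parameters are recovered by division with remainder by `A`, restricted ones are the `U`
  -- themselves.
  set v : ℕ → ℤ := fun k => if k < K then U k / A else U k with hv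
  have hfree : ∀ k < K, S.free v k = U k := by
    intro k hk
    rw [Spec.free, linearSpec_freeData E j x₀ z r hk]
    have h1 : (r.getD k 0 : ℤ) = U k % A := by
      simp [hr, hk, Int.emod_nonneg _ hA]
    have h2 : S.lead = A := rfl
    simp only [h1, h2, hv, if_pos hk]
    exact Int.mul_ediv_add_emod _ _
  have hdiv : ∀ k, v (K + k) = U (K + k) := fun k => by simp [hv]
  have hF : S.numFree = K := linearSpec_numFree E j x₀ z r
  have hD : S.numDiv = (E.divExps j).length := linearSpec_numDiv E j x₀ z r
  -- The solution is the point with `W = 1`; the vector `z` is not needed to represent it.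
  have hcoord : ∀ i : Fin E.nvars, x i = S.coord v 1 i := by
    intro i
    rw [hxU i, Spec.coord, List.length_append, Finset.prod_range_add, one_pow, mul_one, hF, hD,
      mul_assoc]
    congr 2
    · refine Finset.prod_congr rfl fun k hk => ?_
      rw [Finset.mem_range] at hk
      rw [hfree k hk, linearSpec_freeData E j x₀ z r hk, List.getD_append _ _ _ _ hk]
    · refine Finset.prod_congr rfl fun k hk => ?_
      rw [Finset.mem_range] at hk
      rw [hdiv, linearSpec_divData E j x₀ z r hk, List.getD_append_right _ _ _ _ (by omega)]
      simp [hK]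
  -- The equation holds at `x` and its common factor `G` is non-zero, so the linear equation for `W`
  -- holds with `W = 1`. Validity of the residues follows, as `A` divides `den`.
  have hnum : S.num v = S.den v S.numDiv * 1 := by
    obtain ⟨G, hG0, hG⟩ := exists_sum_linearSpec j x₀ hz r v 1 hcoord
    rw [(isSolution_iff j x).mp hx] at hG
    have hG0 := hG0 (fun k hk => by rw [← hS, hfree k hk]; exact hU k)
      (fun k _ => by rw [← hK, hdiv]; exact hU _) one_ne_zero
    have := (mul_eq_zero.mp hG.symm).resolve_left hG0
    linarith
  have hvalid : S.Valid := by
    refine ⟨hA, (S.num_modEq v).dvd_iff.mp ?_⟩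
    rw [hnum, mul_one, Spec.den]
    exact dvd_mul_right _ _
  refine ⟨S, ?_, hvalid, ?_⟩
  · simp only [linearSpecs, List.mem_flatMap, List.mem_map]
    refine ⟨j, by fin_cases j <;> simp, x₀, hx₀, z, hz, r, mem_words.mpr ⟨by simp [hr, hK], ?_⟩, rfl⟩
    intro a ha
    obtain ⟨k, -, rfl⟩ := List.mem_map.mp ha
    have h := Int.emod_lt_abs (U k) hA
    rw [Int.abs_eq_natAbs] at h
    have := Int.emod_nonneg (U k) hA
    rw [List.mem_range, ← hAdef]
    omega
  · refine (Spec.mem_family_points hvalid (basePoints_length hx₀).symm x).mpr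
      ⟨v, 1, fun l _ => ?_, hnum, hcoord⟩
    rw [hF, hdiv]; exact hU _

theorem solve_spec (ha : ∀ j, E.coeff j ≠ 0) (hE : E.Condition) :
    (∀ F ∈ E.solve, F.WellDefined E.nvars) ∧
      {x | E.IsSolution x} = ⋃ F ∈ E.solve, F.points E.nvars := by
  have hmem : ∀ F, F ∈ E.solve ↔ ∃ S, (S ∈ E.scalingSpecs ∨ S ∈ E.linearSpecs) ∧ S.Valid ∧
      S.family = F := by
    intro F
    simp only [solve, List.mem_map, List.mem_filter, List.mem_append, decide_eq_true_eq, and_assoc]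
  have hlen : ∀ S, (S ∈ E.scalingSpecs ∨ S ∈ E.linearSpecs) → S.2.2.2.1.length = E.nvars := by
    rintro S (hS | hS)
    · obtain ⟨x₀, hx₀, rfl⟩ := List.mem_map.mp hS
      exact basePoints_length (List.mem_filter.mp hx₀).1
    · simp only [linearSpecs, List.mem_flatMap, List.mem_map] at hS
      obtain ⟨j, -, x₀, hx₀, z, hz, r, -, rfl⟩ := hS
      exact basePoints_length hx₀
  constructor
  · intro F hF
    obtain ⟨S, hS, hv, rfl⟩ := (hmem F).mp hF
    rw [← hlen S hS]
    exact Spec.family_wellDefined hv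
  · ext x
    simp only [Set.mem_ofPred_eq, Set.mem_iUnion, exists_prop]
    constructor
    · intro hx
      by_cases h : ∃ j, E.coeff j * ∏ i, x i ^ E.exponent j i = 0
      · obtain ⟨j, hj⟩ := h
        obtain ⟨S, hS, hxS⟩ := exists_scalingSpec ha hx hj
        refine ⟨S.family, (hmem _).mpr ⟨S, Or.inl hS, ?_, rfl⟩, hxS⟩
        obtain ⟨x₀, -, rfl⟩ := List.mem_map.mp hS
        exact scalingSpec_valid x₀
      · push Not at h
        obtain ⟨S, hS, hv, hxS⟩ := exists_linearSpec ha hE hx h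
        exact ⟨S.family, (hmem _).mpr ⟨S, Or.inr hS, hv, rfl⟩, hxS⟩
    · rintro ⟨F, hF, hx⟩
      obtain ⟨S, hS, hv, rfl⟩ := (hmem F).mp hF
      rcases hS with hS | hS
      · exact isSolution_of_mem_scalingSpecs hS hx
      · exact isSolution_of_mem_linearSpecs hS hv hx

end Equation
end ThreeMon

/-! ### Primitive recursiveness of the algorithm. -/

namespace ThreeMon
section
attribute [local fun_prop] Primrec

namespace PrimrecFun

section
variable {α β γ : Type*} [Primcodable α] [Primcodable β] [Primcodable γ]

@[fun_prop] theorem fun_id : Primrec fun a : α => a := Primrec.id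

@[fun_prop] theorem fun_const (b : β) : Primrec fun _ : α => b := Primrec.const b

@[fun_prop] theorem fun_comp {f : β → γ} {g : α → β} (hf : Primrec f) (hg : Primrec g) :
    Primrec fun a => f (g a) := hf.comp hg

@[fun_prop] theorem fun_fst {f : α → β × γ} (hf : Primrec f) : Primrec fun a => (f a).1 :=
  Primrec.fst.comp hf

@[fun_prop] theorem fun_snd {f : α → β × γ} (hf : Primrec f) : Primrec fun a => (f a).2 :=
  Primrec.snd.comp hf

@[fun_prop] theorem fun_pair {f : α → β} {g : α → γ} (hf : Primrec f) (hg : Primrec g) :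
    Primrec fun a => (f a, g a) := hf.pair hg

@[fun_prop] theorem fun_natAdd {f g : α → ℕ} (hf : Primrec f) (hg : Primrec g) :
    Primrec fun a => f a + g a := Primrec.nat_add.comp hf hg

@[fun_prop] theorem fun_natSub {f g : α → ℕ} (hf : Primrec f) (hg : Primrec g) :
    Primrec fun a => f a - g a := Primrec.nat_sub.comp hf hg

@[fun_prop] theorem fun_natMul {f g : α → ℕ} (hf : Primrec f) (hg : Primrec g) :
    Primrec fun a => f a * g a := Primrec.nat_mul.comp hf hg

@[fun_prop] theorem fun_natMod {f g : α → ℕ} (hf : Primrec f) (hg : Primrec g) :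
    Primrec fun a => f a % g a := Primrec.nat_mod.comp hf hg

@[fun_prop] theorem fun_natPair {f g : α → ℕ} (hf : Primrec f) (hg : Primrec g) :
    Primrec fun a => Nat.pair (f a) (g a) := Primrec₂.natPair.comp hf hg

-- The powers, finite sums and products, `Expr.prodRange` and `words` below are all reduced to this
-- recursion, in which every ingredient may depend on the input.
@[fun_prop] theorem fun_natRec {f : α → β} {g : α → ℕ → β → β} {h : α → ℕ} (hf : Primrec f)
    (hg : Primrec fun p : α × ℕ × β => g p.1 p.2.1 p.2.2) (hh : Primrec h) :
    Primrec fun a => (Nat.rec (f a) (g a) (h a) : β) :=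
  Primrec.nat_rec' (h := fun a p => g a p.1 p.2) hh hf hg

@[fun_prop] theorem fun_ite {c : α → Prop} [DecidablePred c] {f g : α → β}
    (hc : Primrec fun a => decide (c a)) (hf : Primrec f) (hg : Primrec g) :
    Primrec fun a => if c a then f a else g a :=
  Primrec.ite (primrecPred_iff_primrec_decide.mpr hc) hf hg

@[fun_prop] theorem fun_decideEq [DecidableEq β] {f g : α → β} (hf : Primrec f) (hg : Primrec g) :
    Primrec fun a => decide (f a = g a) :=
  primrecPred_iff_primrec_decide.mp (Primrec.eq.comp hf hg)

@[fun_prop] theorem fun_decideLe {f g : α → ℕ} (hf : Primrec f) (hg : Primrec g) :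
    Primrec fun a => decide (f a ≤ g a) :=
  primrecPred_iff_primrec_decide.mp (Primrec.nat_le.comp hf hg)

@[fun_prop] theorem fun_decideAnd {p q : α → Prop} [DecidablePred p] [DecidablePred q]
    (hp : Primrec fun a => decide (p a)) (hq : Primrec fun a => decide (q a)) :
    Primrec fun a => decide (p a ∧ q a) :=
  primrecPred_iff_primrec_decide.mp
    ((primrecPred_iff_primrec_decide.mpr hp).and (primrecPred_iff_primrec_decide.mpr hq))

@[fun_prop] theorem fun_decideOr {p q : α → Prop} [DecidablePred p] [DecidablePred q]
    (hp : Primrec fun a => decide (p a)) (hq : Primrec fun a => decide (q a)) :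
    Primrec fun a => decide (p a ∨ q a) :=
  primrecPred_iff_primrec_decide.mp
    ((primrecPred_iff_primrec_decide.mpr hp).or (primrecPred_iff_primrec_decide.mpr hq))

@[fun_prop] theorem fun_decideNot {p : α → Prop} [DecidablePred p]
    (hp : Primrec fun a => decide (p a)) : Primrec fun a => decide (¬ p a) :=
  primrecPred_iff_primrec_decide.mp (primrecPred_iff_primrec_decide.mpr hp).not

@[fun_prop] theorem fun_cons {f : α → β} {g : α → List β} (hf : Primrec f) (hg : Primrec g) :
    Primrec fun a => f a :: g a := Primrec.list_cons.comp hf hg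

@[fun_prop] theorem fun_append {f g : α → List β} (hf : Primrec f) (hg : Primrec g) :
    Primrec fun a => f a ++ g a := Primrec.list_append.comp hf hg

@[fun_prop] theorem fun_length {f : α → List β} (hf : Primrec f) : Primrec fun a => (f a).length :=
  Primrec.list_length.comp hf

@[fun_prop] theorem fun_range {f : α → ℕ} (hf : Primrec f) : Primrec fun a => List.range (f a) :=
  Primrec.list_range.comp hf

@[fun_prop] theorem fun_getD {f : α → List β} {g : α → ℕ} (hf : Primrec f) (hg : Primrec g) (d : β) :
    Primrec fun a => (f a).getD (g a) d := (Primrec.list_getD d).comp hf hg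

@[fun_prop] theorem fun_map {f : α → List β} {g : α → β → γ} (hf : Primrec f)
    (hg : Primrec fun p : α × β => g p.1 p.2) : Primrec fun a => (f a).map (g a) :=
  Primrec.list_map hf hg

@[fun_prop] theorem fun_flatMap {f : α → List β} {g : α → β → List γ} (hf : Primrec f)
    (hg : Primrec fun p : α × β => g p.1 p.2) : Primrec fun a => (f a).flatMap (g a) :=
  Primrec.list_flatMap hf hg

@[fun_prop] theorem fun_filter {f : α → List β} {g : α → β → Bool} (hf : Primrec f)
    (hg : Primrec fun p : α × β => g p.1 p.2) : Primrec fun a => (f a).filter (g a) := by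
  have : Primrec fun a => (f a).flatMap fun b => if g a b = true then [b] else [] := by fun_prop
  refine this.of_eq fun a => ?_
  induction f a with
  | nil => rfl
  | cons b l ih =>
    rw [List.flatMap_cons, List.filter_cons, ih]
    split_ifs <;> rfl

@[fun_prop] theorem fun_finAdd {f : α → Fin 3} (k : Fin 3) (hf : Primrec f) :
    Primrec fun a => f a + k := (Primrec.dom_finite fun i : Fin 3 => i + k).comp hf

@[fun_prop] theorem fun_natPow {f g : α → ℕ} (hf : Primrec f) (hg : Primrec g) :
    Primrec fun a => f a ^ g a := by
  have : Primrec fun a => (Nat.rec 1 (fun _ y => y * f a) (g a) : ℕ) := by fun_prop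
  refine this.of_eq fun a => ?_
  induction g a with
  | zero => rfl
  | succ n ih => rw [pow_succ, ← ih]

@[fun_prop] theorem fun_natSum {f : α → ℕ → ℕ} {g : α → ℕ}
    (hf : Primrec fun p : α × ℕ => f p.1 p.2) (hg : Primrec g) :
    Primrec fun a => ∑ k ∈ Finset.range (g a), f a k := by
  have : Primrec fun a => (Nat.rec 0 (fun k y => y + f a k) (g a) : ℕ) := by fun_prop
  refine this.of_eq fun a => ?_
  induction g a with
  | zero => rfl
  | succ n ih => rw [Finset.sum_range_succ, ← ih]

/-! Integer arithmetic -/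

/-- Integers are coded with non-negative ones at even and negative ones at odd numbers. Once the
positive and negative parts are primitive recursive, addition and multiplication are written as
differences of natural numbers. -/
theorem encode_ofNat (n : ℕ) : Encodable.encode (n : ℤ) = 2 * n := rfl

theorem encode_negSucc (n : ℕ) : Encodable.encode (Int.negSucc n) = 2 * n + 1 := rfl

@[fun_prop] theorem fun_intCast {f : α → ℕ} (hf : Primrec f) : Primrec fun a => (f a : ℤ) := by
  refine Primrec.encode_iff.mp ?_
  simp only [encode_ofNat]
  fun_prop

@[fun_prop] theorem fun_negSucc {f : α → ℕ} (hf : Primrec f) : Primrec fun a => Int.negSucc (f a) := by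
  refine Primrec.encode_iff.mp ?_
  simp only [encode_negSucc]
  fun_prop

@[fun_prop] theorem fun_encode {f : α → β} (hf : Primrec f) : Primrec fun a => Encodable.encode (f a) :=
  Primrec.encode.comp hf

@[fun_prop] theorem fun_div2 {f : α → ℕ} (hf : Primrec f) : Primrec fun a => f a / 2 :=
  Primrec.nat_div.comp hf (Primrec.const 2)

@[fun_prop] theorem fun_toNat {f : α → ℤ} (hf : Primrec f) : Primrec fun a => (f a).toNat := by
  have : Primrec fun a => if Encodable.encode (f a) % 2 = 0 then Encodable.encode (f a) / 2 else 0 := by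
    fun_prop
  refine this.of_eq fun a => ?_
  rcases f a with n | n
  · rw [Int.ofNat_eq_natCast, encode_ofNat, if_pos (by omega)]; simp
  · rw [encode_negSucc, if_neg (by omega)]; simp

@[fun_prop] theorem fun_intNatSub {f g : α → ℕ} (hf : Primrec f) (hg : Primrec g) :
    Primrec fun a => (f a : ℤ) - (g a : ℤ) := by
  have : Primrec fun a => if g a ≤ f a then ((f a - g a : ℕ) : ℤ) else Int.negSucc (g a - f a - 1) := by
    fun_prop
  refine this.of_eq fun a => ?_
  split_ifs <;> omega

@[fun_prop] theorem fun_intNeg {f : α → ℤ} (hf : Primrec f) : Primrec fun a => -f a := by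
  have : Primrec fun a => if Encodable.encode (f a) % 2 = 0 then
      (0 : ℕ) - (((f a).toNat : ℕ) : ℤ) else ((Encodable.encode (f a) / 2 + 1 : ℕ) : ℤ) := by
    fun_prop
  refine this.of_eq fun a => ?_
  rcases f a with n | n
  · rw [Int.ofNat_eq_natCast, encode_ofNat, if_pos (by omega)]; simp
  · rw [encode_negSucc, if_neg (by omega)]; omega

@[fun_prop] theorem fun_intAdd {f g : α → ℤ} (hf : Primrec f) (hg : Primrec g) :
    Primrec fun a => f a + g a := by
  have : Primrec fun a => (((f a).toNat + (g a).toNat : ℕ) : ℤ) -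
      (((-f a).toNat + (-g a).toNat : ℕ) : ℤ) := by fun_prop
  exact this.of_eq fun a => by omega

@[fun_prop] theorem fun_intSub {f g : α → ℤ} (hf : Primrec f) (hg : Primrec g) :
    Primrec fun a => f a - g a := by
  simp only [sub_eq_add_neg]; fun_prop

@[fun_prop] theorem fun_intMul {f g : α → ℤ} (hf : Primrec f) (hg : Primrec g) :
    Primrec fun a => f a * g a := by
  have : Primrec fun a => (((f a).toNat * (g a).toNat + (-f a).toNat * (-g a).toNat : ℕ) : ℤ) -
      (((f a).toNat * (-g a).toNat + (-f a).toNat * (g a).toNat : ℕ) : ℤ) := by fun_prop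
  refine this.of_eq fun a => ?_
  have h1 := Int.toNat_sub_toNat_neg (f a)
  have h2 := Int.toNat_sub_toNat_neg (g a)
  conv_rhs => rw [← h1, ← h2]
  push_cast
  ring

@[fun_prop] theorem fun_natAbs {f : α → ℤ} (hf : Primrec f) : Primrec fun a => (f a).natAbs := by
  have : Primrec fun a => (f a).toNat + (-f a).toNat := by fun_prop
  exact this.of_eq fun a => by omega

@[fun_prop] theorem fun_intPow {f : α → ℤ} {g : α → ℕ} (hf : Primrec f) (hg : Primrec g) :
    Primrec fun a => f a ^ g a := by
  have : Primrec fun a => (Nat.rec 1 (fun _ y => y * f a) (g a) : ℤ) := by fun_prop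
  refine this.of_eq fun a => ?_
  induction g a with
  | zero => exact (pow_zero _).symm
  | succ n ih => rw [pow_succ, ← ih]

@[fun_prop] theorem fun_intProd {f : α → ℕ → ℤ} {g : α → ℕ}
    (hf : Primrec fun p : α × ℕ => f p.1 p.2) (hg : Primrec g) :
    Primrec fun a => ∏ k ∈ Finset.range (g a), f a k := by
  have : Primrec fun a => (Nat.rec 1 (fun k y => y * f a k) (g a) : ℤ) := by fun_prop
  refine this.of_eq fun a => ?_
  induction g a with
  | zero => rfl
  | succ n ih => rw [Finset.prod_range_succ, ← ih]

@[fun_prop] theorem fun_decideDvd {f g : α → ℤ} (hf : Primrec f) (hg : Primrec g) :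
    Primrec fun a => decide (f a ∣ g a) := by
  have : Primrec fun a => decide ((g a).natAbs % (f a).natAbs = 0) := by fun_prop
  refine this.of_eq fun a => ?_
  rw [decide_eq_decide, ← Nat.dvd_iff_mod_eq_zero, Int.natAbs_dvd_natAbs]

/-! Expressions -/

-- The code of an expression is by definition an arithmetic function of the codes of its parts, so
-- each constructor is primitive recursive.
@[fun_prop] theorem fun_exprConst {f : α → ℤ} (hf : Primrec f) : Primrec fun a => Expr.const (f a) := by
  refine Primrec.encode_iff.mp ?_
  change Primrec fun a => 6 * Encodable.encode (f a)
  fun_prop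

@[fun_prop] theorem fun_exprVar {f : α → ℕ} (hf : Primrec f) : Primrec fun a => Expr.var (f a) := by
  refine Primrec.encode_iff.mp ?_
  change Primrec fun a => 6 * f a + 1
  fun_prop

@[fun_prop] theorem fun_exprAdd {f g : α → Expr} (hf : Primrec f) (hg : Primrec g) :
    Primrec fun a => Expr.add (f a) (g a) := by
  refine Primrec.encode_iff.mp ?_
  change Primrec fun a => 6 * Nat.pair (Encodable.encode (f a)) (Encodable.encode (g a)) + 2
  fun_prop

@[fun_prop] theorem fun_exprMul {f g : α → Expr} (hf : Primrec f) (hg : Primrec g) :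
    Primrec fun a => Expr.mul (f a) (g a) := by
  refine Primrec.encode_iff.mp ?_
  change Primrec fun a => 6 * Nat.pair (Encodable.encode (f a)) (Encodable.encode (g a)) + 3
  fun_prop

@[fun_prop] theorem fun_exprDiv {f g : α → Expr} (hf : Primrec f) (hg : Primrec g) :
    Primrec fun a => Expr.div (f a) (g a) := by
  refine Primrec.encode_iff.mp ?_
  change Primrec fun a => 6 * Nat.pair (Encodable.encode (f a)) (Encodable.encode (g a)) + 4
  fun_prop

@[fun_prop] theorem fun_exprPow {f : α → Expr} {g : α → ℕ} (hf : Primrec f) (hg : Primrec g) :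
    Primrec fun a => Expr.pow (f a) (g a) := by
  refine Primrec.encode_iff.mp ?_
  change Primrec fun a => 6 * Nat.pair (Encodable.encode (f a)) (g a) + 5
  fun_prop

@[fun_prop] theorem fun_prodRange {f : α → ℕ → Expr} {g : α → ℕ}
    (hf : Primrec fun p : α × ℕ => f p.1 p.2) (hg : Primrec g) :
    Primrec fun a => Expr.prodRange (f a) (g a) := by
  unfold Expr.prodRange; fun_prop

@[fun_prop] theorem fun_words {f : α → List β} {g : α → ℕ} (hf : Primrec f) (hg : Primrec g) :
    Primrec fun a => words (f a) (g a) := by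
  unfold words; fun_prop

end

/-! Families -/

section
variable {α : Type*} [Primcodable α] {S : α → Spec} {f : α → ℕ}

@[fun_prop] theorem fun_lead (hS : Primrec S) : Primrec fun a => (S a).lead := by
  unfold Spec.lead; fun_prop

@[fun_prop] theorem fun_numFree (hS : Primrec S) : Primrec fun a => (S a).numFree := by
  unfold Spec.numFree; fun_prop

@[fun_prop] theorem fun_numDiv (hS : Primrec S) : Primrec fun a => (S a).numDiv := by
  unfold Spec.numDiv; fun_prop

@[fun_prop] theorem fun_freeData (hS : Primrec S) (hf : Primrec f) :
    Primrec fun a => (S a).freeData (f a) := by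
  unfold Spec.freeData; fun_prop

@[fun_prop] theorem fun_divData (hS : Primrec S) (hf : Primrec f) :
    Primrec fun a => (S a).divData (f a) := by
  unfold Spec.divData; fun_prop

@[fun_prop] theorem fun_freeExpr (hS : Primrec S) (hf : Primrec f) :
    Primrec fun a => (S a).freeExpr (f a) := by
  unfold Spec.freeExpr; fun_prop

@[fun_prop] theorem fun_numExpr (hS : Primrec S) : Primrec fun a => (S a).numExpr := by
  unfold Spec.numExpr; fun_prop

@[fun_prop] theorem fun_quotExpr (hS : Primrec S) (hf : Primrec f) :
    Primrec fun a => (S a).quotExpr (f a) := by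
  unfold Spec.quotExpr Spec.denExpr; fun_prop

@[fun_prop] theorem fun_coordExpr (hS : Primrec S) (hf : Primrec f) :
    Primrec fun a => (S a).coordExpr (f a) := by
  unfold Spec.coordExpr Spec.base Spec.baseExp; fun_prop

@[fun_prop] theorem fun_family (hS : Primrec S) : Primrec fun a => (S a).family := by
  unfold Spec.family Spec.ranges; fun_prop

@[fun_prop] theorem fun_valid (hS : Primrec S) : Primrec fun a => decide (S a).Valid := by
  have : Primrec fun a => decide ((S a).lead ≠ 0 ∧ (S a).lead ∣
    (S a).1.2.1 * ∏ k ∈ Finset.range (S a).numFree, ((S a).freeData k).1 ^ ((S a).freeData k).2.1.1 +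
      (S a).1.2.2 *
        ∏ k ∈ Finset.range (S a).numFree, ((S a).freeData k).1 ^ ((S a).freeData k).2.1.2) := by
    fun_prop
  exact this.of_eq fun a => decide_eq_decide.mpr Iff.rfl

end

/-! The algorithm -/

section
variable {α : Type*} [Primcodable α] {E : α → Equation} {j : α → Fin 3} {x : α → List ℤ}
  {z : α → List ℕ}

@[fun_prop] theorem fun_coeff (hE : Primrec E) (hj : Primrec j) :
    Primrec fun a => (E a).coeff (j a) :=
  Primrec.fin_app.comp (Primrec.fst.comp hE) hj

@[fun_prop] theorem fun_expAt {f : α → ℕ} (hE : Primrec E) (hj : Primrec j) (hf : Primrec f) :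
    Primrec fun a => (E a).expAt (j a) (f a) :=
  Primrec.fin_app.comp (fun_getD (Primrec.snd.comp hE) hf 0) hj

@[fun_prop] theorem fun_size (hE : Primrec E) : Primrec fun a => (E a).size := by
  unfold Equation.size; fun_prop

@[fun_prop] theorem fun_eqBound {f g : α → ℕ} (hf : Primrec f) (hg : Primrec g) :
    Primrec fun a => eqBound (f a) (g a) := by
  unfold eqBound; fun_prop

@[fun_prop] theorem fun_sysBound {f g : α → ℕ} (hf : Primrec f) (hg : Primrec g) :
    Primrec fun a => sysBound (f a) (g a) := by
  unfold sysBound; fun_prop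

@[fun_prop] theorem fun_listWeight (hE : Primrec E) (hj : Primrec j) (hz : Primrec z) :
    Primrec fun a => (E a).listWeight (j a) (z a) := by
  unfold Equation.listWeight; fun_prop

@[fun_prop] theorem fun_termAt (hE : Primrec E) (hj : Primrec j) (hx : Primrec x) :
    Primrec fun a => (E a).termAt (j a) (x a) := by
  unfold Equation.termAt; fun_prop

@[fun_prop] theorem fun_expBound (hE : Primrec E) : Primrec fun a => (E a).expBound := by
  unfold Equation.expBound; fun_prop

@[fun_prop] theorem fun_box (hE : Primrec E) : Primrec fun a => (E a).box := by
  unfold Equation.box; fun_prop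

@[fun_prop] theorem fun_basePoints (hE : Primrec E) : Primrec fun a => (E a).basePoints := by
  unfold Equation.basePoints Equation.baseBound; fun_prop

@[fun_prop] theorem fun_freeExps (hE : Primrec E) (hj : Primrec j) :
    Primrec fun a => (E a).freeExps (j a) := by
  unfold Equation.freeExps; fun_prop

@[fun_prop] theorem fun_divExps (hE : Primrec E) (hj : Primrec j) :
    Primrec fun a => (E a).divExps (j a) := by
  unfold Equation.divExps; fun_prop

@[fun_prop] theorem fun_linearExps (hE : Primrec E) (hj : Primrec j) :
    Primrec fun a => (E a).linearExps (j a) := by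
  unfold Equation.linearExps; fun_prop

@[fun_prop] theorem fun_balancedExps (hE : Primrec E) (hx : Primrec x) :
    Primrec fun a => (E a).balancedExps (x a) := by
  unfold Equation.balancedExps; fun_prop

@[fun_prop] theorem fun_scalingSpec (hE : Primrec E) (hx : Primrec x) :
    Primrec fun a => (E a).scalingSpec (x a) := by
  unfold Equation.scalingSpec; fun_prop

@[fun_prop] theorem fun_linearSpec {r : α → List ℕ} (hE : Primrec E) (hj : Primrec j)
    (hx : Primrec x) (hz : Primrec z) (hr : Primrec r) :
    Primrec fun a => (E a).linearSpec (j a) (x a) (z a) (r a) := by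
  unfold Equation.linearSpec; fun_prop

@[fun_prop] theorem fun_scalingSpecs (hE : Primrec E) : Primrec fun a => (E a).scalingSpecs := by
  unfold Equation.scalingSpecs; fun_prop

@[fun_prop] theorem fun_linearSpecs (hE : Primrec E) : Primrec fun a => (E a).linearSpecs := by
  unfold Equation.linearSpecs; fun_prop

theorem primrec_solve : Primrec Equation.solve := by
  unfold Equation.solve; fun_prop

end
end PrimrecFun
end
end ThreeMon

/-! ### The elementary form of the equations to which the reduction leads. -/

namespace ThreeMon

section
open MvPolynomial

theorem notMem_vars_add {σ R : Type*} [CommSemiring R] {i : σ} {p q : MvPolynomial σ R}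
    (hp : i ∉ p.vars) (hq : i ∉ q.vars) : i ∉ (p + q).vars := by
  classical
  exact fun h => (Finset.mem_union.mp (vars_add_subset p q h)).elim hp hq

theorem notMem_vars_mul {σ R : Type*} [CommSemiring R] {i : σ} {p q : MvPolynomial σ R}
    (hp : i ∉ p.vars) (hq : i ∉ q.vars) : i ∉ (p * q).vars := by
  classical
  exact fun h => (Finset.mem_union.mp (vars_mul p q h)).elim hp hq

theorem notMem_vars_prod_X_pow {σ ι R : Type*} [CommSemiring R] [Nontrivial R] {i : σ} (s : Finset ι)
    (g : ι → σ) (e : ι → ℕ) (h : ∀ k ∈ s, g k ≠ i) :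
    i ∉ (∏ k ∈ s, (X (g k) : MvPolynomial σ R) ^ e k).vars := by
  classical
  intro hi
  obtain ⟨k, hk, hik⟩ := Finset.mem_biUnion.mp (vars_prod _ hi)
  have := vars_pow _ _ hik
  rw [vars_X, Finset.mem_singleton] at this
  exact h k hk this.symm

/-- An equation in which a variable with the exponent one occurs in a single term, whose variables
do not occur elsewhere, is of one of the elementary forms. -/
theorem elementaryForm_of_linear_term {σ ι : Type} [DecidableEq σ] [DecidableEq ι] {t : ℤ} (ht : t ≠ 0)
    {i : σ} {g : ι → σ} (hg : Function.Injective g) (e : ι → ℕ) {Q : MvPolynomial σ ℤ}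
    (hi : i ∉ Q.vars) (s : Finset ι) (hs : ∀ k ∈ s, g k ≠ i ∧ g k ∉ Q.vars) :
    ElementaryForm (C t * (X i * ∏ k ∈ s, X (g k) ^ e k) + Q) := by
  induction s using Finset.induction_on with
  | empty => simpa using ElementaryForm.linear t i Q ht hi
  | insert k s hk ih =>
    have ih := ih fun l hl => hs l (Finset.mem_insert_of_mem hl)
    obtain ⟨hki, hkQ⟩ := hs k (Finset.mem_insert_self _ _)
    rw [Finset.prod_insert hk]
    rcases Nat.eq_zero_or_pos (e k) with h0 | h0
    · rw [h0, pow_zero, one_mul]; exact ih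
    have hC : g k ∉ (C t : MvPolynomial σ ℤ).vars := by rw [vars_C]; exact Finset.notMem_empty _
    have hX : g k ∉ (X i : MvPolynomial σ ℤ).vars := by simpa [vars_X] using hki
    have hP : g k ∉ (∏ l ∈ s, (X (g l) : MvPolynomial σ ℤ) ^ e l).vars :=
      notMem_vars_prod_X_pow s g e fun l hl h => hk (hg h ▸ hl)
    -- The substitution of `X (g k) ^ e k * X i` for `X i` inserts the new factor. It fixes `Q` and
    -- the other factors, in which `X i` does not occur. A factor with exponent 0 was dismissed
    -- before, since the form requires `k ≥ 1`.
    have := ElementaryForm.powMul (g k) i (e k) _ hki h0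
      (notMem_vars_add (notMem_vars_mul hC (notMem_vars_mul hX hP)) hkQ) ih
    convert this using 1
    have hQ : bind₁ (Function.update X i (X (g k) ^ e k * X i)) Q = Q := by
      refine hom_congr_vars (f₁ := (bind₁ (Function.update X i (X (g k) ^ e k * X i)) :
        MvPolynomial σ ℤ →ₐ[ℤ] MvPolynomial σ ℤ).toRingHom) (f₂ := RingHom.id _) ?_ ?_ rfl
      · ext; simp
      · intro l hl _
        have : l ≠ i := fun h => hi (h ▸ hl)
        simp [this]
    have hprod : bind₁ (Function.update X i (X (g k) ^ e k * X i))
        (∏ l ∈ s, (X (g l) : MvPolynomial σ ℤ) ^ e l) = ∏ l ∈ s, X (g l) ^ e l := by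
      rw [map_prod]
      refine Finset.prod_congr rfl fun l hl => ?_
      simp [(hs l (Finset.mem_insert_of_mem hl)).1]
    rw [map_add, map_mul, map_mul, hQ, hprod, bind₁_X_right, Function.update_self,
      bind₁_C_right]
    ring

end

namespace Equation
variable {E : Equation}

/-- The minimal solutions generate all solutions. -/
theorem mem_closure_of_weight_eq {j : Fin 3} {l : List (Fin E.nvars → ℕ)}
    (hl : E.IsListOfMinimalSolutions j l) (z : Fin E.nvars → ℕ)
    (hz : E.weight (j + 1) z = E.weight (j + 2) z) :
    z ∈ AddSubmonoid.closure {e | e ∈ l} := by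
  induction hN : ∑ i, z i using Nat.strong_induction_on generalizing z with
  | _ N ih =>
  by_cases h0 : z = 0
  · rw [h0]; exact zero_mem _
  obtain ⟨b, hbz, hb⟩ := exists_minimal_le_of_wellFoundedLT
    (fun z => z ≠ 0 ∧ E.weight (j + 1) z = E.weight (j + 2) z) z ⟨h0, hz⟩
  obtain ⟨y, rfl⟩ : ∃ y, z = y + b := ⟨z - b, (tsub_add_cancel_of_le hbz).symm⟩
  have hpos : 0 < ∑ i, b i := by
    rw [Nat.pos_iff_ne_zero]
    intro h
    exact hb.1.1 (funext fun i => by simpa using (Finset.sum_eq_zero_iff.mp h) i (Finset.mem_univ i))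
  have hlt : ∑ i, y i < N := by
    rw [← hN]; simp only [Pi.add_apply, Finset.sum_add_distrib]; omega
  have hb2 := hb.1.2
  rw [weight_add, weight_add] at hz
  exact add_mem (ih _ hlt y (by omega) rfl) (AddSubmonoid.subset_closure ((hl.2 b).mpr hb))

theorem netExponent_add (j : Fin 3) (y z : Fin E.nvars → ℕ) :
    E.netExponent j (y + z) = E.netExponent j y + E.netExponent j z := by
  simp only [netExponent, weight_add]; push_cast; ring

theorem netExponent_zero (j : Fin 3) : E.netExponent j 0 = 0 := by simp [netExponent, weight]

theorem reducedCoeff_ne_zero (cls : ℕ → Fin 3) (z₀ : ℕ → Fin E.nvars → ℕ) (j : Fin 3) :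
    E.reducedCoeff cls z₀ j ≠ 0 := by
  refine Finset.prod_ne_zero_iff.mpr fun p hp => zpow_ne_zero _ ?_
  exact_mod_cast (Nat.prime_of_mem_primeFactors (Finset.mem_filter.mp hp).1).ne_zero

/-- The two monomials of equal weight in the condition are `j + 1` and `j + 2` in some order, where
`j` is the third one. -/
theorem exists_netExponent_eq_one (hE : E.Condition) : ∃ (j : Fin 3) (z : Fin E.nvars → ℕ),
    E.weight (j + 1) z = E.weight (j + 2) z ∧ E.netExponent j z = 1 := by
  obtain ⟨i, i', j, h1, h2, h3, z, hz1, hz2⟩ := hE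
  have hi : (i = j + 1 ∧ i' = j + 2) ∨ (i = j + 2 ∧ i' = j + 1) := by
    clear hz1 hz2
    revert i i' j; decide
  refine ⟨j, z, ?_⟩
  rw [netExponent]
  rcases hi with ⟨rfl, rfl⟩ | ⟨rfl, rfl⟩ <;> constructor <;> omega

end Equation

theorem foldr_gcd_dvd {l : List ℕ} {a : ℕ} (ha : a ∈ l) : l.foldr Nat.gcd 0 ∣ a := by
  induction l with
  | nil => simp at ha
  | cons b l ih =>
    rw [List.foldr_cons]
    rcases List.mem_cons.mp ha with rfl | h
    · exact Nat.gcd_dvd_left _ _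
    · exact (Nat.gcd_dvd_right _ _).trans (ih h)

theorem poly_eq_term_add (R : IndepEquation) (j : Fin 3) :
    R.poly = MvPolynomial.C (R j).1 *
        ∏ k : Fin (R j).2.length, MvPolynomial.X (j, (k : ℕ)) ^ (R j).2[k] +
      ∑ l ∈ Finset.univ.erase j, MvPolynomial.C (R l).1 *
        ∏ k : Fin (R l).2.length, MvPolynomial.X (l, (k : ℕ)) ^ (R l).2[k] :=
  (Finset.add_sum_erase _ _ (Finset.mem_univ j)).symm

/-- Variables carry the number of their term, so distinct terms share none. -/
theorem notMem_vars_other_terms (R : IndepEquation) (j : Fin 3) (k : ℕ) :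
    (j, k) ∉ (∑ l ∈ Finset.univ.erase j, MvPolynomial.C (R l).1 *
      ∏ k : Fin (R l).2.length, MvPolynomial.X (l, (k : ℕ)) ^ (R l).2[k]).vars := by
  intro h
  obtain ⟨l, hl, h⟩ := Finset.mem_biUnion.mp (MvPolynomial.vars_sum_subset _ _ h)
  exact notMem_vars_mul (by rw [MvPolynomial.vars_C]; exact Finset.notMem_empty _)
    (notMem_vars_prod_X_pow _ _ _ fun _ _ h => Finset.ne_of_mem_erase hl (congrArg Prod.fst h)) h

/-- The equation is elementary if a term has a variable with the exponent one. -/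
theorem elementaryForm_poly (R : IndepEquation) (j : Fin 3) (ht : (R j).1 ≠ 0) (h : 1 ∈ (R j).2) :
    ElementaryForm R.poly := by
  obtain ⟨k, hk, hk1⟩ := List.mem_iff_getElem.mp h
  rw [poly_eq_term_add R j, ← Finset.mul_prod_erase _ _ (Finset.mem_univ (⟨k, hk⟩ : Fin (R j).2.length))]
  simp only [Fin.getElem_fin, hk1, pow_one]
  refine elementaryForm_of_linear_term ht (g := fun k : Fin (R j).2.length => (j, (k : ℕ)))
    (fun a b hab => Fin.ext (congrArg Prod.snd hab)) _ (notMem_vars_other_terms R j k) _ fun l hl => ?_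
  refine ⟨fun h => Finset.ne_of_mem_erase hl (Fin.ext (congrArg Prod.snd h)), notMem_vars_other_terms R j l⟩

namespace Equation
variable {E : Equation}

/-- The net exponent is additive and takes the value 1 on a sum of minimal solutions. Properties of
its values on these (non-positive, divisible by `d`, non-negative and never 1) that would pass to
sums without allowing the value 1 are thereby excluded. -/
theorem elementaryForm_of_reducesTo (hE : E.Condition) {R : IndepEquation} (hR : E.ReducesTo R) :
    ElementaryForm R.poly := by
  obtain ⟨l, cls, z₀, s, hl, -, hrep⟩ := hR
  obtain ⟨j, z, hz, hz1⟩ := exists_netExponent_eq_one hE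
  have hmem := mem_closure_of_weight_eq (hl j) z hz
  have hr0 : ((s j : ℤ) : ℚ) * E.reducedCoeff cls z₀ j ≠ 0 :=
    mul_ne_zero (by exact_mod_cast (s j).ne_zero) (reducedCoeff_ne_zero _ _ _)
  suffices H : (R j).1 ≠ 0 ∧ 1 ∈ (R j).2 from elementaryForm_poly R j H.1 H.2
  generalize hRj : R j = T
  have hT := hrep j
  rw [hRj] at hT
  cases hT with
  | nonpos c m hes hr hm =>
    exfalso
    have : E.netExponent j z ≤ 0 := by
      clear hz1 hz
      induction hmem using AddSubmonoid.closure_induction with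
      | mem e he => exact hes _ (List.mem_map_of_mem he)
      | zero => rw [netExponent_zero]
      | add a b _ _ iha ihb => rw [netExponent_add]; omega
    omega
  | mixed d v q t hpos hneg hd hv hvr hq ht =>
    have hd1 : d = 1 := by
      have : (d : ℤ) ∣ E.netExponent j z := by
        clear hz1 hz
        induction hmem using AddSubmonoid.closure_induction with
        | mem e he =>
          rw [← Int.dvd_natAbs, Int.natCast_dvd_natCast, hd]
          exact foldr_gcd_dvd (List.mem_map_of_mem (List.mem_map_of_mem he))
        | zero => rw [netExponent_zero]; exact dvd_zero _
        | add a b _ _ iha ihb => rw [netExponent_add]; exact dvd_add iha ihb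
      rw [hz1] at this
      exact Nat.dvd_one.mp (by exact_mod_cast this)
    refine ⟨?_, by simp [hd1]⟩
    have hq0 : (q : ℚ) ≠ 0 := by exact_mod_cast hq.1.1.ne'
    have hv0 : (v : ℚ) ≠ 0 := by exact_mod_cast hv.ne'
    have : (t : ℚ) ≠ 0 := by
      rw [ht]
      exact div_ne_zero (mul_ne_zero hr0 (pow_ne_zero _ hq0)) (pow_ne_zero _ hv0)
    exact_mod_cast this
  | nonneg ks d t hes hd ht =>
    -- In `hes` the coercion is applied to the list `ks` as a monadic lift, followed by the identity
    -- map; this is rewritten as the entrywise cast.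
    have hks : (l j).map (E.netExponent j) = ks.map (Nat.cast : ℕ → ℤ) := by
      rw [hes, List.map_id']
      exact List.flatMap_pure_eq_map _ _
    have hnn : ∀ e ∈ l j, 0 ≤ E.netExponent j e := by
      intro e he
      have : E.netExponent j e ∈ (l j).map (E.netExponent j) := List.mem_map_of_mem he
      rw [hks] at this
      obtain ⟨k, -, hk⟩ := List.mem_map.mp this
      rw [← hk]; exact Int.natCast_nonneg k
    have h1 : 0 ≤ E.netExponent j z ∧ (E.netExponent j z = 1 → ∃ e ∈ l j, E.netExponent j e = 1) := by
      clear hz1 hz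
      induction hmem using AddSubmonoid.closure_induction with
      | mem e he => exact ⟨hnn e he, fun h => ⟨e, he, h⟩⟩
      | zero => simp [netExponent_zero]
      | add a b _ _ iha ihb =>
        rw [netExponent_add]
        refine ⟨by omega, fun h => ?_⟩
        by_cases h' : E.netExponent j a = 1
        · exact iha.2 h'
        · exact ihb.2 (by omega)
    obtain ⟨e, he, he1⟩ := h1.2 hz1
    constructor
    · have : (t : ℚ) ≠ 0 := by
        rw [ht]
        exact mul_ne_zero hr0 (Finset.prod_ne_zero_iff.mpr fun k _ =>
          pow_ne_zero _ (by exact_mod_cast (hd.1 k).ne'))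
      exact_mod_cast this
    · have : (1 : ℤ) ∈ (l j).map (E.netExponent j) := he1 ▸ List.mem_map_of_mem he
      rw [hks] at this
      obtain ⟨k, hk, hk1⟩ := List.mem_map.mp this
      obtain rfl : k = 1 := by exact_mod_cast hk1
      exact hk

end Equation
end ThreeMon

theorem proposition3p4 :
    (∃ solve : ThreeMon.Equation → List ThreeMon.Family, Computable solve ∧
      ∀ E : ThreeMon.Equation, (∀ j, E.coeff j ≠ 0) → E.Condition →
        (∀ F ∈ solve E, F.WellDefined E.nvars) ∧
        {x | E.IsSolution x} = ⋃ F ∈ solve E, F.points E.nvars) ∧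
    ∀ E : ThreeMon.Equation, (∀ j, E.coeff j ≠ 0) → E.Condition →
      ∀ R : ThreeMon.IndepEquation, E.ReducesTo R → ThreeMon.ElementaryForm R.poly :=
  ⟨⟨ThreeMon.Equation.solve, ThreeMon.PrimrecFun.primrec_solve.to_comp,
    fun _ ha hE => ThreeMon.Equation.solve_spec ha hE⟩,
   fun _ _ hE _ hR => ThreeMon.Equation.elementaryForm_of_reducesTo hE hR⟩
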